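/- Let $d$ be an odd positive integer. A function $f:\mathbb Z/d\mathbb Z\to\mathbb C$ is called $\lambda$-critical ($\lambda\in\mathbb C$) if $f\neq 0$ and $\sum_{s\in\mathbb Z/d\mathbb Z} f(s)f(2t-s)=\lambda f(t)^2$ for all $t\in\mathbb Z/d\mathbb Z$. For $\tau\in\mathbb H=\{\tau\in\mathbb C: \operatorname{Im}\tau>0\}$ let $\theta_\tau(z)=\sum_{m\in\mathbb Z}e^{i\pi\tau m^2}e^{2i\pi mz}$ $(z\in\mathbb C)$; $\theta_\tau$ is called $(\lambda,d)$-critical if for every $z\in\mathbb C$ the function $\ell\mapsto\theta_\tau(z+\ell/d)$ is $\lambda$-critical on $\mathbb Z/d\mathbb Z$. Call $(a,b)$ admissible if $a,b$ are positive integers with $a+b=d$ and $a\equiv\frac{(d+1)^2}{4}\pmod 4$; for such a pair put $$\lambda_0:=\sqrt a+i\sqrt b,\qquad \tau_0:=\frac{a-b-d^2+2i\sqrt{ab}}{4d^2}\in\mathbb H,\qquad N_k:=d^2|k+\tau_0|^2\quad(k\in\mathbb Z).$$ Then: (a) For every admissible pair $(a,b)$, $\theta_{\tau_0}$ is $(\lambda_0,d)$-critical.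 (b) Conversely, if $\tau\in\mathbb H$, $\lambda\in\mathbb C$ and $\theta_\tau$ is $(\lambda,d)$-critical, then $\lambda=\pm\sqrt a\pm i\sqrt b$ for some admissible pair $(a,b)$ and some choice of the two signs. (c) Let $(a,b)$ be admissible. All the $N_k$ are integers, and for $\tau\in\mathbb H$ the function $\theta_\tau$ is $(\lambda,d)$-critical for $\lambda=\lambda_0$ or $\lambda=-\lambda_0$ if and only if $\tau=(k+\tau_0)/p$ for some $k\in\mathbb Z$ and some positive divisor $p$ of $N_k$. (d) Let $(a,b)$ be admissible, $k\in\mathbb Z$, and $p>0$ a divisor of $N_k$. For $\tau=(k+\tau_0)/p$, the unique $\lambda$ such that $\theta_\tau$ is $(\lambda,d)$-critical is $\lambda=\varepsilon\lambda_0$, where $\varepsilon=\left(\frac{p}{4k-1}\right)\in\{1,-1\}$ is the Jacobi symbol, with the convention $\left(\frac{p}{n}\right)=\left(\frac{p}{-n}\right)$ for negative odd $n$. Moreover, for $\tau\in\mathbb H$ and $\lambda\in\mathbb C$, $\theta_\tau$ is $(\lambda,d)$-critical if and only if $\theta_{-\bar\tau}$ is $(\bar\lambda,d)$-critical, so that (a)–(d)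 describe all triples $(d,\lambda,\tau)$ with $d$ odd. -/

import Mathlib

open Complex

/-- `f : G → ℂ` is a `lam`-critical function on the finite abelian group `G`: it is non-zero and
its convolution square satisfies `(f ⋆ f)(2t) = lam * f(t)^2` for all `t`. -/
def IsCriticalFunction {G : Type*} [AddCommGroup G] [Fintype G] (lam : ℂ) (f : G → ℂ) : Prop :=
  f ≠ 0 ∧ ∀ t : G, ∑ s : G, f s * f (2 • t - s) = lam * f t ^ 2

/-- The function `f_{z,τ} : ℓ ↦ θ(z + ℓ/d, τ)` on `ℤ/dℤ`, where
`θ(z, τ) = ∑ m : ℤ, exp (π i τ m²) exp (2 π i m z)`. The representative in `{0, …, d - 1}` is used;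
any other one gives the same value, see `thetaSample_intCast`. -/
noncomputable def thetaSample (d : ℕ) (τ z : ℂ) (l : ZMod d) : ℂ :=
  jacobiTheta₂ (z + (l.val : ℂ) / (d : ℂ)) τ

theorem thetaSample_intCast (d : ℕ) [NeZero d] (τ z : ℂ) (n : ℤ) :
    thetaSample d τ z (n : ZMod d) = jacobiTheta₂ (z + (n : ℂ) / (d : ℂ)) τ := by
  have hd : (d : ℂ) ≠ 0 := Nat.cast_ne_zero.mpr (NeZero.ne d)
  have hper : ∀ (m : ℤ) (w : ℂ), jacobiTheta₂ (w + m) τ = jacobiTheta₂ w τ := by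
    intro m w
    have h : Function.Periodic (fun u : ℂ => jacobiTheta₂ u τ) 1 :=
      fun u => jacobiTheta₂_add_left u τ
    simpa using h.int_mul m w
  have hv : (((n : ZMod d).val : ℤ)) = n % d := ZMod.val_intCast n
  have hn : (n : ℂ) = (((n : ZMod d).val : ℕ) : ℂ) + (d : ℂ) * ((n / d : ℤ) : ℂ) := by
    have h := Int.emod_add_mul_ediv n d
    rw [← hv] at h
    exact_mod_cast h.symm
  rw [thetaSample, ← hper (n / d) (z + _)]
  congr 1
  rw [hn]
  field_simp
  ring

/-- `θ_τ` is `(lam, d)`-critical: for every `z`, the function `ℓ ↦ θ(z + ℓ/d, τ)` is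
`lam`-critical on `ℤ/dℤ`. -/
def IsThetaCritical (lam : ℂ) (d : ℕ) [NeZero d] (τ : ℂ) : Prop :=
  ∀ z : ℂ, IsCriticalFunction lam (thetaSample d τ z)

/-- The admissible pairs for odd `d`: positive integers with `a + b = d` and
`a ≡ (d + 1)² / 4 (mod 4)` (the division is exact since `d` is odd). -/
def IsAdmissiblePair (d a b : ℕ) : Prop :=
  0 < a ∧ 0 < b ∧ a + b = d ∧ a ≡ (d + 1) ^ 2 / 4 [MOD 4]

/-- The number `√a + i √b`. -/
noncomputable def lambdaZero (a b : ℕ) : ℂ := (√(a : ℝ) : ℂ) + I * (√(b : ℝ) : ℂ)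

/-- The fundamental parameter `τ₀ = (a - b - d² + 2 i √(ab)) / (4 d²)`. -/
noncomputable def tauZero (d a b : ℕ) : ℂ :=
  ((a : ℂ) - (b : ℂ) - (d : ℂ) ^ 2 + 2 * I * (√((a : ℝ) * (b : ℝ)) : ℂ)) / (4 * (d : ℂ) ^ 2)

/-- `N` is the integer `N_k = d² |k + τ₀|²`. -/
def IsNk (d a b : ℕ) (k N : ℤ) : Prop :=
  (N : ℝ) = (d : ℝ) ^ 2 * ‖(k : ℂ) + tauZero d a b‖ ^ 2

/-- The Jacobi symbol `(p / (4k - 1))`, with the convention `(p / n) = (p / (-n))` for negative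
odd `n`. -/
def signSymbol (k : ℤ) (p : ℕ) : ℤ := jacobiSym (p : ℤ) (4 * k - 1).natAbs

/-! Write A, B for `thetaEven`, `thetaOdd`. They satisfy θ_τ(z+u)θ_τ(z-u) = A(z)A(u) + B(z)B(u).
Summing over u = s/d and using the distribution relation, and since A and B are linearly
independent, criticality for odd d > 1 amounts to d·A_{d²τ}(0) = λ·A_τ(0) together with the same
equation for B (`isThetaCritical_iff`). So τ and d²τ must have the same ratio of theta constants,
and λ measures the common factor.

That ratio determines τ up to Γ(4) (`exists_gamma_four_of_proportional`). Indeed the duplication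
formulas for A and B have coefficients depending only on the ratio, and their even solutions are
rigid (`duplication_unique`), so equal ratios make the theta functions agree up to a dilation and a
Gaussian factor. Comparing zeros then shows that the dilation comes from an integral matrix,
diagonal mod 4; the inverse similarity forces its determinant to be 1. Conversely `thetaTransforms`
gives the exact multiplier, a Jacobi symbol times √(cτ+δ), by a Euclidean descent on c.

Hence criticality means d²τ = (ατ+β)/(cτ+δ) with a matrix in Γ(4), and λ = ±d√(cτ+δ). Then λ² is a
non-real root of X² - TX + d² with T = α + d²δ. The congruences on the matrix make T = 2(a-b) with
(a,b) admissible, so λ² = (√a ± i√b)². When λ² = λ₀², writing c = 4p and δ = 1-4k in λ² = d²(cτ+δ)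
gives τ = (k+τ₀)/p. Determinant 1 says exactly that p divides N_k, and the multiplier gives the
sign. -/

open scoped Real NumberTheorySymbols

open Filter Topology

/-! ### Even and odd parts of theta, and the addition formula. -/

/-- The even part `∑ exp (2 π i (τ m² + 2 m z))`, `m ∈ ℤ`, of `θ (z, τ / 2)`. -/
noncomputable def thetaEven (τ z : ℂ) : ℂ := jacobiTheta₂ (2 * z) (2 * τ)

/-- The odd part `∑ exp (2 π i (τ m² + 2 m z))`, `m ∈ ℤ + 1 / 2`, of `θ (z, τ / 2)`. -/
noncomputable def thetaOdd (τ z : ℂ) : ℂ :=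
  cexp (π * I * τ / 2 + 2 * π * I * z) * jacobiTheta₂ (2 * z + τ) (2 * τ)

theorem HasSum.of_eq {ι : Type*} {f g : ι → ℂ} {a : ℂ} (h : HasSum f a) (e : ∀ i, g i = f i) :
    HasSum g a := by
  rwa [funext e]

theorem two_mul_im_pos {τ : ℂ} (hτ : 0 < τ.im) : 0 < (2 * τ).im := by
  simpa using hτ

theorem half_im_pos {τ : ℂ} (hτ : 0 < τ.im) : 0 < (τ / 2).im := by
  simpa using hτ

theorem hasSum_thetaEven {τ : ℂ} (hτ : 0 < τ.im) (z : ℂ) :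
    HasSum (fun m : ℤ => jacobiTheta₂_term (2 * m) z (τ / 2)) (thetaEven τ z) := by
  refine (hasSum_jacobiTheta₂_term (2 * z) (two_mul_im_pos hτ)).of_eq fun m => ?_
  simp only [jacobiTheta₂_term]
  push_cast
  ring_nf

theorem hasSum_thetaOdd {τ : ℂ} (hτ : 0 < τ.im) (z : ℂ) :
    HasSum (fun m : ℤ => jacobiTheta₂_term (2 * m + 1) z (τ / 2)) (thetaOdd τ z) := by
  refine ((hasSum_jacobiTheta₂_term (2 * z + τ) (two_mul_im_pos hτ)).mul_left
    (cexp (π * I * τ / 2 + 2 * π * I * z))).of_eq fun m => ?_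
  simp only [jacobiTheta₂_term, ← Complex.exp_add]
  push_cast
  ring_nf

/-- A sum over `ℤ` splits into its even and odd parts. -/
theorem Int.hasSum_even_add_odd {f : ℤ → ℂ} {a b : ℂ} (ha : HasSum (fun m : ℤ => f (2 * m)) a)
    (hb : HasSum (fun m : ℤ => f (2 * m + 1)) b) : HasSum f (a + b) := by
  have h2 : Function.Injective fun m : ℤ => 2 * m := fun x y h => by simpa using h
  have h3 : Function.Injective fun m : ℤ => 2 * m + 1 := fun x y h => by simpa using h
  have h2' := (h2.hasSum_range_iff (f := f)).mpr ha
  have h3' := (h3.hasSum_range_iff (f := f)).mpr hb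
  refine h2'.add_isCompl ?_ h3'
  refine ⟨?_, ?_⟩
  · rw [Set.disjoint_left]
    rintro _ ⟨x, rfl⟩ ⟨y, hy⟩
    simp only at hy
    omega
  · rw [codisjoint_iff_le_sup]
    intro n _
    rcases Int.even_or_odd' n with ⟨k, h | h⟩
    · exact Or.inl ⟨k, h.symm⟩
    · exact Or.inr ⟨k, h.symm⟩

theorem jacobiTheta₂_half_eq {τ : ℂ} (hτ : 0 < τ.im) (z : ℂ) :
    jacobiTheta₂ z (τ / 2) = thetaEven τ z + thetaOdd τ z :=
  (hasSum_jacobiTheta₂_term z (half_im_pos hτ)).unique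
    (Int.hasSum_even_add_odd (hasSum_thetaEven hτ z) (hasSum_thetaOdd hτ z))

theorem thetaEven_neg (τ z : ℂ) : thetaEven τ (-z) = thetaEven τ z := by
  rw [thetaEven, thetaEven, ← jacobiTheta₂_neg_left]
  ring_nf

theorem thetaOdd_neg (τ z : ℂ) : thetaOdd τ (-z) = thetaOdd τ z := by
  rw [thetaOdd, thetaOdd, ← jacobiTheta₂_neg_left,
    show -(2 * -z + τ) = (2 * z - τ) by ring,
    show (2 * z + τ) = (2 * z - τ) + 2 * τ by ring, jacobiTheta₂_add_left', ← mul_assoc,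
    ← Complex.exp_add]
  ring_nf

theorem thetaEven_add_half (τ z : ℂ) : thetaEven τ (z + 1 / 2) = thetaEven τ z := by
  rw [thetaEven, thetaEven, ← jacobiTheta₂_add_left (2 * z)]
  ring_nf

/-- The half shift fixes the even part and negates the odd part. Evaluating a linear relation
between the two at z and z + 1/2 therefore separates it, which is how their independence is used
throughout. -/
theorem thetaOdd_add_half (τ z : ℂ) : thetaOdd τ (z + 1 / 2) = -thetaOdd τ z := by
  rw [thetaOdd, thetaOdd, show 2 * (z + 1 / 2) + τ = (2 * z + τ) + 1 by ring,
    jacobiTheta₂_add_left, show (π * I * τ / 2 + 2 * π * I * (z + 1 / 2) : ℂ) =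
      π * I * τ / 2 + 2 * π * I * z + π * I by ring, Complex.exp_add _ (π * I), exp_pi_mul_I]
  ring

theorem thetaEven_add_half_tau (τ z : ℂ) :
    thetaEven τ (z + τ / 2) = cexp (-(π * I * τ / 2 + 2 * π * I * z)) * thetaOdd τ z := by
  rw [thetaEven, thetaOdd, ← mul_assoc, ← Complex.exp_add]
  ring_nf
  simp

theorem thetaOdd_add_half_tau (τ z : ℂ) :
    thetaOdd τ (z + τ / 2) = cexp (-(π * I * τ / 2 + 2 * π * I * z)) * thetaEven τ z := by
  rw [thetaEven, thetaOdd, show 2 * (z + τ / 2) + τ = 2 * z + 2 * τ by ring,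
    jacobiTheta₂_add_left', ← mul_assoc, ← Complex.exp_add]
  ring_nf

theorem jacobiTheta₂_half_add_half_eq {τ : ℂ} (hτ : 0 < τ.im) (z : ℂ) :
    jacobiTheta₂ (z + 1 / 2) (τ / 2) = thetaEven τ z - thetaOdd τ z := by
  rw [jacobiTheta₂_half_eq hτ, thetaEven_add_half, thetaOdd_add_half, sub_eq_add_neg]

theorem hasSum_prod_mul {f g : ℤ → ℂ} {a b : ℂ} (hf : HasSum f a) (hg : HasSum g b) :
    HasSum (fun x : ℤ × ℤ => f x.1 * g x.2) (a * b) :=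
  hf.mul hg (summable_mul_of_summable_norm hf.summable.norm hg.summable.norm)

/-- The addition formula for products of theta functions. -/
theorem jacobiTheta₂_add_mul_sub {τ : ℂ} (hτ : 0 < τ.im) (z u : ℂ) :
    jacobiTheta₂ (z + u) τ * jacobiTheta₂ (z - u) τ =
      thetaEven τ z * thetaEven τ u + thetaOdd τ z * thetaOdd τ u := by
  have key : ∀ (m n p q : ℤ), m + n = 2 * p → m - n = 2 * q →
      jacobiTheta₂_term m z (τ / 2) * jacobiTheta₂_term n u (τ / 2) =
        jacobiTheta₂_term p (z + u) τ * jacobiTheta₂_term q (z - u) τ := by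
    intro m n p q h1 h2
    obtain rfl : m = p + q := by omega
    obtain rfl : n = p - q := by omega
    simp only [jacobiTheta₂_term, ← Complex.exp_add]
    push_cast
    ring_nf
  have hL := hasSum_prod_mul (hasSum_jacobiTheta₂_term (z + u) hτ)
    (hasSum_jacobiTheta₂_term (z - u) hτ)
  have hE := hasSum_prod_mul (hasSum_thetaEven hτ z) (hasSum_thetaEven hτ u)
  have hO := hasSum_prod_mul (hasSum_thetaOdd hτ z) (hasSum_thetaOdd hτ u)
  refine hL.unique ?_
  -- With (m, n) = (p + q, p - q), the index pairs split by the parity of m + n: even sums come from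
  -- the product of even parts, odd sums from that of odd parts.
  have i1 : Function.Injective fun x : ℤ × ℤ => (x.1 + x.2, x.1 - x.2) := by
    rintro ⟨a, b⟩ ⟨c, d⟩ h
    simp only [Prod.mk.injEq] at h ⊢
    omega
  have i2 : Function.Injective fun x : ℤ × ℤ => (x.1 + x.2 + 1, x.1 - x.2) := by
    rintro ⟨a, b⟩ ⟨c, d⟩ h
    simp only [Prod.mk.injEq] at h ⊢
    omega
  refine HasSum.add_isCompl (s := Set.range fun x : ℤ × ℤ => (x.1 + x.2, x.1 - x.2))
    (t := Set.range fun x : ℤ × ℤ => (x.1 + x.2 + 1, x.1 - x.2)) ⟨?_, ?_⟩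
    ((i1.hasSum_range_iff (f := fun x : ℤ × ℤ => jacobiTheta₂_term x.1 (z + u) τ *
      jacobiTheta₂_term x.2 (z - u) τ)).mpr ?_)
    ((i2.hasSum_range_iff (f := fun x : ℤ × ℤ => jacobiTheta₂_term x.1 (z + u) τ *
      jacobiTheta₂_term x.2 (z - u) τ)).mpr ?_)
  · rw [Set.disjoint_left]
    rintro _ ⟨x, rfl⟩ ⟨y, hy⟩
    simp only [Prod.mk.injEq] at hy
    omega
  · rw [codisjoint_iff_le_sup]
    rintro ⟨m, n⟩ _
    rcases Int.even_or_odd' (m + n) with ⟨k, h | h⟩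
    · exact Or.inl ⟨(k, m - k), by simp only [Prod.mk.injEq]; omega⟩
    · exact Or.inr ⟨(k, m - k - 1), by simp only [Prod.mk.injEq]; omega⟩
  · refine hE.of_eq fun x => ?_
    exact (key _ _ _ _ (by ring) (by ring)).symm
  · refine hO.of_eq fun x => ?_
    exact (key _ _ _ _ (by ring) (by ring)).symm

/-- The addition formula after translation by the half period `(1 + τ) / 2`. -/
theorem jacobiTheta₂_add_mul_sub_halfPeriod {τ : ℂ} (hτ : 0 < τ.im) (x y : ℂ) :
    jacobiTheta₂ (x + y + (1 + τ) / 2) τ * jacobiTheta₂ (x - y + (1 + τ) / 2) τ =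
      cexp (-(π * I * τ / 2 + 2 * π * I * x)) *
        (thetaOdd τ x * thetaEven τ y - thetaEven τ x * thetaOdd τ y) := by
  rw [show x + y + (1 + τ) / 2 = (x + τ / 2 + 1 / 2) + y by ring,
    show x - y + (1 + τ) / 2 = (x + τ / 2 + 1 / 2) - y by ring, jacobiTheta₂_add_mul_sub hτ,
    thetaEven_add_half, thetaOdd_add_half, thetaEven_add_half_tau, thetaOdd_add_half_tau]
  ring

/-! ### The distribution relation over d-division points. -/

theorem natCast_sq_mul_im_pos {τ : ℂ} (hτ : 0 < τ.im) (d : ℕ) [NeZero d] :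
    0 < ((d : ℂ) ^ 2 * τ).im := by
  have h : ((d : ℂ) ^ 2 * τ) = ((d : ℝ) ^ 2 : ℝ) * τ := by push_cast; ring
  rw [h, Complex.im_ofReal_mul]
  have : (0 : ℝ) < d := Nat.cast_pos.mpr (Nat.pos_of_ne_zero (NeZero.ne d))
  positivity

/-- The distribution relation for the theta function. -/
theorem sum_jacobiTheta₂_add_div {τ : ℂ} (hτ : 0 < τ.im) (d : ℕ) [NeZero d] (z : ℂ) :
    ∑ s ∈ Finset.range d, jacobiTheta₂ (z + s / d) τ =
      d * jacobiTheta₂ (d * z) ((d : ℂ) ^ 2 * τ) := by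
  have hd : (d : ℂ) ≠ 0 := Nat.cast_ne_zero.mpr (NeZero.ne d)
  have hdτ := natCast_sq_mul_im_pos hτ d
  have h1 : HasSum (fun n : ℤ => ∑ s ∈ Finset.range d, jacobiTheta₂_term n (z + s / d) τ)
      (∑ s ∈ Finset.range d, jacobiTheta₂ (z + s / d) τ) :=
    hasSum_sum fun s _ => hasSum_jacobiTheta₂_term _ hτ
  have hterm : ∀ n : ℤ, ∑ s ∈ Finset.range d, jacobiTheta₂_term n (z + s / d) τ =
      jacobiTheta₂_term n z τ * ∑ s ∈ Finset.range d, cexp (2 * π * I * n / d) ^ s := by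
    intro n
    rw [Finset.mul_sum]
    refine Finset.sum_congr rfl fun s _ => ?_
    rw [← Complex.exp_nat_mul]
    simp only [jacobiTheta₂_term, ← Complex.exp_add]
    ring_nf
  have inj : Function.Injective fun j : ℤ => (d : ℤ) * j := fun a b h => by
    have : (d : ℤ) ≠ 0 := by exact_mod_cast NeZero.ne d
    exact mul_left_cancel₀ this h
  refine h1.unique ?_
  -- The character sum over s kills every frequency not divisible by d.
  rw [← inj.hasSum_iff]
  · refine ((hasSum_jacobiTheta₂_term (d * z) hdτ).mul_left (d : ℂ)).of_eq fun j => ?_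
    rw [Function.comp_apply, hterm]
    have : cexp (2 * π * I * ((d * j : ℤ) : ℂ) / d) = 1 := by
      rw [Complex.exp_eq_one_iff]
      exact ⟨j, by push_cast; field_simp⟩
    rw [this]
    simp only [one_pow, Finset.sum_const, Finset.card_range, nsmul_eq_mul, mul_one,
      jacobiTheta₂_term]
    push_cast
    ring_nf
  · intro n hn
    rw [hterm]
    have hne : cexp (2 * π * I * n / d) ≠ 1 := by
      rw [Ne, Complex.exp_eq_one_iff]
      rintro ⟨j, hj⟩
      refine hn ⟨j, ?_⟩
      have hpi : (2 * π * I : ℂ) ≠ 0 := Complex.two_pi_I_ne_zero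
      rw [div_eq_iff hd] at hj
      have : (n : ℂ) = d * j := by
        apply mul_left_cancel₀ hpi
        linear_combination hj
      simp only
      exact_mod_cast this.symm
    rw [geom_sum_eq hne, ← Complex.exp_nat_mul,
      show (d : ℂ) * (2 * π * I * n / d) = n * (2 * π * I) by field_simp,
      Complex.exp_int_mul_two_pi_mul_I]
    simp

/-! ### Zeros of theta and non-vanishing of theta constants. -/

theorem differentiable_jacobiTheta₂ {τ : ℂ} (hτ : 0 < τ.im) :
    Differentiable ℂ (jacobiTheta₂ · τ) :=
  fun z => differentiableAt_jacobiTheta₂_fst z hτ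

theorem differentiable_thetaEven {τ : ℂ} (hτ : 0 < τ.im) : Differentiable ℂ (thetaEven τ) :=
  (differentiable_jacobiTheta₂ (two_mul_im_pos hτ)).comp (differentiable_id.const_mul 2)

theorem differentiable_thetaOdd {τ : ℂ} (hτ : 0 < τ.im) : Differentiable ℂ (thetaOdd τ) := by
  have h := (differentiable_jacobiTheta₂ (two_mul_im_pos hτ)).comp
    ((differentiable_id.const_mul (2 : ℂ)).add_const τ)
  unfold thetaOdd
  exact Differentiable.mul (by fun_prop) h

/-- If theta vanished identically, the distribution relation would give θ(0, d²τ) = 0 for all d,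
whereas this value tends to 1 as d grows. -/
theorem exists_jacobiTheta₂_ne_zero {τ : ℂ} (hτ : 0 < τ.im) : ∃ z, jacobiTheta₂ z τ ≠ 0 := by
  by_contra! h
  have h0 : ∀ d : ℕ, 0 < d → jacobiTheta (((d : ℂ) ^ 2) * τ) = 0 := by
    intro d hd
    have : NeZero d := ⟨hd.ne'⟩
    have := sum_jacobiTheta₂_add_div hτ d 0
    simp only [h, Finset.sum_const_zero, mul_zero] at this
    rw [jacobiTheta_eq_jacobiTheta₂]
    have hd' : (d : ℂ) ≠ 0 := Nat.cast_ne_zero.mpr hd.ne'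
    simpa [hd'] using this.symm
  obtain ⟨N, hN⟩ := exists_nat_gt (2 / τ.im)
  have hNpos : 0 < N := by
    have : (0 : ℝ) < N := lt_trans (by positivity) hN
    exact_mod_cast this
  have him : ((N : ℂ) ^ 2 * τ).im = (N : ℝ) ^ 2 * τ.im := by
    have : ((N : ℂ) ^ 2 * τ) = ((N : ℝ) ^ 2 : ℝ) * τ := by push_cast; ring
    rw [this, Complex.im_ofReal_mul]
  have hN1 : (1 : ℝ) ≤ N := by exact_mod_cast hNpos
  have h2 : 2 < (N : ℝ) ^ 2 * τ.im := by
    rw [div_lt_iff₀ hτ] at hN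
    nlinarith
  have hb := norm_jacobiTheta_sub_one_le (τ := (N : ℂ) ^ 2 * τ) (by rw [him]; linarith)
  rw [h0 N hNpos, him] at hb
  set E := Real.exp (-π * ((N : ℝ) ^ 2 * τ.im)) with hE
  have hE4 : E * 4 < 1 := by
    have h3 : Real.exp (-π * ((N : ℝ) ^ 2 * τ.im)) < Real.exp (-(2 * 2)) := by
      apply Real.exp_lt_exp.mpr
      nlinarith [Real.pi_gt_three]
    have h4 : (2 * 2 : ℝ) + 1 ≤ Real.exp (2 * 2) := Real.add_one_le_exp _
    have h5 : Real.exp (-(2 * 2)) * Real.exp (2 * 2) = 1 := by rw [← Real.exp_add]; simp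
    have h6 : 0 < Real.exp (-(2 * 2)) := Real.exp_pos _
    rw [hE]
    nlinarith
  have hEpos : 0 < E := Real.exp_pos _
  rw [div_mul_eq_mul_div, le_div_iff₀ (by linarith)] at hb
  simp only [zero_sub, norm_neg, norm_one] at hb
  linarith

theorem eq_of_eventuallyEq_of_differentiable {f g : ℂ → ℂ} (hf : Differentiable ℂ f)
    (hg : Differentiable ℂ g) {z₀ : ℂ} (h : f =ᶠ[𝓝 z₀] g) : f = g :=
  AnalyticOnNhd.eq_of_eventuallyEq (fun z _ => hf.analyticAt z) (fun z _ => hg.analyticAt z) h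

theorem exists_ne_zero_and_ne_zero {f g : ℂ → ℂ} (hf : Differentiable ℂ f)
    (hg : Differentiable ℂ g) (hf0 : ∃ z, f z ≠ 0) (hg0 : ∃ z, g z ≠ 0) :
    ∃ z, f z ≠ 0 ∧ g z ≠ 0 := by
  obtain ⟨z, hz⟩ := hf0
  obtain ⟨w, hw⟩ := hg0
  by_contra! h
  refine hw (congrFun (eq_of_eventuallyEq_of_differentiable hg (differentiable_const 0)
    (z₀ := z) ?_) w)
  filter_upwards [hf.continuous.continuousAt.eventually_ne hz] with x hx using h x hx

/-- Two entire functions whose logarithmic derivatives differ by the constant `η` are proportional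
up to `exp (η s)`. -/
theorem exists_eq_const_mul_exp_mul {f g : ℂ → ℂ} (hf : Differentiable ℂ f)
    (hg : Differentiable ℂ g) (η : ℂ)
    (h : ∀ s, g s * deriv f s - f s * deriv g s = η * f s * g s) {s₀ : ℂ} (h0 : g s₀ ≠ 0) :
    ∃ C : ℂ, ∀ s, f s = C * cexp (η * s) * g s := by
  obtain ⟨r, hr, hball⟩ := Metric.eventually_nhds_iff_ball.mp
    (hg.continuous.continuousAt.eventually_ne h0)
  -- The quotient is locally constant where g does not vanish; the identity theorem extends the
  -- proportionality to the whole plane.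
  set q : ℂ → ℂ := fun s => f s / g s * cexp (-(η * s)) with hq
  have hderiv : ∀ s ∈ Metric.ball s₀ r, HasDerivAt q 0 s := by
    intro s hs
    have hgs := hball s hs
    have h1 := ((hf s).hasDerivAt.div (hg s).hasDerivAt hgs).mul
      (((hasDerivAt_id s).const_mul η).neg.cexp)
    refine h1.congr_deriv ?_
    simp only [id, Pi.div_apply]
    rw [show deriv f s = (η * f s * g s + f s * deriv g s) / g s by
      rw [eq_div_iff hgs]; linear_combination h s]
    field_simp
    ring
  have hconst : ∀ s ∈ Metric.ball s₀ r, q s = q s₀ := by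
    intro s hs
    refine (Metric.isOpen_ball).is_const_of_deriv_eq_zero
      (convex_ball s₀ r).isPreconnected (fun x hx => (hderiv x hx).differentiableAt.differentiableWithinAt)
      (fun x hx => (hderiv x hx).deriv) hs (Metric.mem_ball_self hr)
  refine ⟨q s₀, fun s => congrFun (eq_of_eventuallyEq_of_differentiable hf
    (g := fun s => q s₀ * cexp (η * s) * g s) (by fun_prop) (z₀ := s₀) ?_) s⟩
  filter_upwards [Metric.ball_mem_nhds s₀ hr] with x hx
  have hgx := hball x hx
  rw [← hconst x hx, hq]
  simp only [Complex.exp_neg]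
  field_simp [Complex.exp_ne_zero]

theorem jacobiTheta₂_halfPeriod {τ : ℂ} (hτ : 0 < τ.im) : jacobiTheta₂ ((1 + τ) / 2) τ = 0 := by
  have h := jacobiTheta₂_add_mul_sub_halfPeriod hτ 0 0
  simpa [mul_comm] using h

theorem jacobiTheta₂_add_lattice_eq_zero_iff (τ z : ℂ) (m n : ℤ) :
    jacobiTheta₂ (z + m + n * τ) τ = 0 ↔ jacobiTheta₂ z τ = 0 := by
  have h1 : Function.Periodic (fun z => jacobiTheta₂ z τ = 0) 1 := fun z => by
    simp only [jacobiTheta₂_add_left]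
  have h2 : Function.Periodic (fun z => jacobiTheta₂ z τ = 0) τ := fun z => by
    simp [jacobiTheta₂_add_left', Complex.exp_ne_zero]
  have h3 := h1.int_mul m z
  have h4 := h2.int_mul n (z + m)
  simp only [mul_one] at h3 h4
  rw [h4, h3]

/-- A zero of the theta function, counted from the half period, is a period up to an exponential
factor, and hence a lattice point. -/
theorem mem_lattice_of_jacobiTheta₂_eq_zero {τ : ℂ} (hτ : 0 < τ.im) {w : ℂ}
    (hw : jacobiTheta₂ (w + (1 + τ) / 2) τ = 0) : ∃ m n : ℤ, w = m + n * τ := by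
  -- The assumed zero makes the vectors (A, B) at y and y + w parallel for every y.
  have hpar : ∀ y, thetaOdd τ (y + w) * thetaEven τ y = thetaEven τ (y + w) * thetaOdd τ y := by
    intro y
    have h := jacobiTheta₂_add_mul_sub_halfPeriod hτ (y + w) y
    rw [show y + w - y + (1 + τ) / 2 = w + (1 + τ) / 2 by ring, hw, mul_zero, eq_comm,
      mul_eq_zero, or_iff_right (Complex.exp_ne_zero _)] at h
    exact sub_eq_zero.mp h
  set θ : ℂ → ℂ := (jacobiTheta₂ · τ) with hθdef
  have hθ : Differentiable ℂ θ := differentiable_jacobiTheta₂ hτ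
  set φ : ℂ → ℂ := fun s => θ (s + w) with hφdef
  have hφ : Differentiable ℂ φ := hθ.comp (differentiable_id.add_const w)
  -- By parallelism, φ(s)φ(t) / (θ(s)θ(t)) depends only on s + t. Differentiating in e at 0 shows
  -- that φ'/φ - θ'/θ is constant.
  have hG : ∀ s t e, φ s * φ t * (θ (s + e) * θ (t - e)) =
      θ s * θ t * (φ (s + e) * φ (t - e)) := by
    intro s t e
    have e1 := jacobiTheta₂_add_mul_sub hτ ((s + t) / 2 + w) ((s - t) / 2)
    have e2 := jacobiTheta₂_add_mul_sub hτ ((s + t) / 2) ((s - t) / 2 + e)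
    have e3 := jacobiTheta₂_add_mul_sub hτ ((s + t) / 2) ((s - t) / 2)
    have e4 := jacobiTheta₂_add_mul_sub hτ ((s + t) / 2 + w) ((s - t) / 2 + e)
    have hp := hpar ((s + t) / 2)
    simp only [hφdef, hθdef]
    rw [show s + w = (s + t) / 2 + w + (s - t) / 2 by ring,
      show t + w = (s + t) / 2 + w - (s - t) / 2 by ring, e1,
      show s + e = (s + t) / 2 + ((s - t) / 2 + e) by ring,
      show t - e = (s + t) / 2 - ((s - t) / 2 + e) by ring, e2,
      show (s + t) / 2 + ((s - t) / 2 + e) + w = (s + t) / 2 + w + ((s - t) / 2 + e) by ring,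
      show (s + t) / 2 - ((s - t) / 2 + e) + w = (s + t) / 2 + w - ((s - t) / 2 + e) by ring, e4,
      show jacobiTheta₂ s τ = jacobiTheta₂ ((s + t) / 2 + (s - t) / 2) τ by ring_nf,
      show jacobiTheta₂ t τ = jacobiTheta₂ ((s + t) / 2 - (s - t) / 2) τ by ring_nf, e3]
    linear_combination (thetaOdd τ ((s - t) / 2) * thetaEven τ ((s - t) / 2 + e) -
      thetaEven τ ((s - t) / 2) * thetaOdd τ ((s - t) / 2 + e)) * hp
  have hD : ∀ s t, φ s * φ t * (deriv θ s * θ t - θ s * deriv θ t) =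
      θ s * θ t * (deriv φ s * φ t - φ s * deriv φ t) := by
    intro s t
    have hd : ∀ f : ℂ → ℂ, Differentiable ℂ f →
        HasDerivAt (fun e => f (s + e) * f (t - e)) (deriv f s * f t - f s * deriv f t) 0 := by
      intro f hf
      have h1 : HasDerivAt (fun e => f (s + e)) (deriv f s) 0 := by
        have := HasDerivAt.comp_const_add s 0 (f := f) (f' := deriv f s)
          (by rw [add_zero]; exact (hf s).hasDerivAt)
        exact this
      have h2 : HasDerivAt (fun e => f (t - e)) (-deriv f t) 0 := by
        have := HasDerivAt.comp_const_sub t 0 (f := f) (f' := deriv f t)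
          (by rw [sub_zero]; exact (hf t).hasDerivAt)
        exact this
      refine (h1.mul h2).congr_deriv ?_
      simp only [add_zero, sub_zero]
      ring
    have h1 := (hd θ hθ).const_mul (φ s * φ t)
    have h2 := (hd φ hφ).const_mul (θ s * θ t)
    rw [← funext (hG s t)] at h2
    exact h1.unique h2
  obtain ⟨s₀, h0, h0'⟩ : ∃ s, θ s ≠ 0 ∧ φ s ≠ 0 := by
    obtain ⟨z, hz⟩ := exists_jacobiTheta₂_ne_zero hτ
    exact exists_ne_zero_and_ne_zero hθ hφ ⟨z, hz⟩ ⟨z - w, by simpa [hφdef, hθdef] using hz⟩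
  set η : ℂ := deriv φ s₀ / φ s₀ - deriv θ s₀ / θ s₀ with hη
  obtain ⟨C, hC⟩ := exists_eq_const_mul_exp_mul hφ hθ η (fun s => by
    have h := hD s s₀
    rw [hη]
    field_simp
    linear_combination -h) h0
  have hC0 : C ≠ 0 := by
    rintro rfl
    exact h0' (by rw [hC]; ring)
  -- The period 1 forces η into 2πiℤ; the quasi-period τ then expresses w through η.
  have hper : cexp η = 1 := by
    have h1 := hC (s₀ + 1)
    have h2 : φ (s₀ + 1) = φ s₀ := by
      simp only [hφdef, hθdef]
      rw [← jacobiTheta₂_add_left (s₀ + w)]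
      ring_nf
    have h3 : θ (s₀ + 1) = θ s₀ := jacobiTheta₂_add_left s₀ τ
    rw [h2, h3, hC s₀, mul_add, Complex.exp_add, mul_one] at h1
    have h4 : C * cexp (η * s₀) * θ s₀ ≠ 0 :=
      mul_ne_zero (mul_ne_zero hC0 (Complex.exp_ne_zero _)) h0
    apply mul_left_cancel₀ h4
    linear_combination -h1
  obtain ⟨n, hn⟩ := Complex.exp_eq_one_iff.mp hper
  have hquasi : cexp (-(2 * π * I * w)) = cexp (η * τ) := by
    have h1 := hC (s₀ + τ)
    have h2 : φ (s₀ + τ) = cexp (-π * I * (τ + 2 * (s₀ + w))) * φ s₀ := by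
      simp only [hφdef, hθdef]
      rw [← jacobiTheta₂_add_left' (s₀ + w)]
      ring_nf
    have h3 : θ (s₀ + τ) = cexp (-π * I * (τ + 2 * s₀)) * θ s₀ := jacobiTheta₂_add_left' s₀ τ
    rw [h2, h3, hC s₀, mul_add η, Complex.exp_add (η * s₀),
      show (-π * I * (τ + 2 * (s₀ + w)) : ℂ) = -π * I * (τ + 2 * s₀) + -(2 * π * I * w) by ring,
      Complex.exp_add] at h1
    have h4 : cexp (-π * I * (τ + 2 * s₀)) * (C * cexp (η * s₀) * θ s₀) ≠ 0 :=
      mul_ne_zero (Complex.exp_ne_zero _)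
        (mul_ne_zero (mul_ne_zero hC0 (Complex.exp_ne_zero _)) h0)
    apply mul_left_cancel₀ h4
    linear_combination h1
  obtain ⟨m, hm⟩ := Complex.exp_eq_exp_iff_exists_int.mp hquasi
  refine ⟨-m, -n, ?_⟩
  apply mul_left_cancel₀ Complex.two_pi_I_ne_zero
  push_cast
  linear_combination -hm - τ * hn

/-- The zeros of the theta function. -/
theorem jacobiTheta₂_eq_zero_iff {τ : ℂ} (hτ : 0 < τ.im) (z : ℂ) :
    jacobiTheta₂ z τ = 0 ↔ ∃ m n : ℤ, z = (1 + τ) / 2 + m + n * τ := by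
  constructor
  · intro h
    obtain ⟨m, n, hmn⟩ := mem_lattice_of_jacobiTheta₂_eq_zero hτ (w := z - (1 + τ) / 2)
      (by rwa [sub_add_cancel])
    exact ⟨m, n, by linear_combination hmn⟩
  · rintro ⟨m, n, rfl⟩
    rw [jacobiTheta₂_add_lattice_eq_zero_iff]
    exact jacobiTheta₂_halfPeriod hτ

/-- This zero set and that of A - B below are the two compared under a similarity of theta
functions; the base points 1/4 and τ/4 are what produce the congruences mod 4. -/
theorem thetaOdd_eq_zero_iff {τ : ℂ} (hτ : 0 < τ.im) (z : ℂ) :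
    thetaOdd τ z = 0 ↔ ∃ m n : ℤ, z = 1 / 4 + m / 2 + n * τ := by
  rw [thetaOdd, mul_eq_zero, or_iff_right (Complex.exp_ne_zero _),
    jacobiTheta₂_eq_zero_iff (two_mul_im_pos hτ)]
  refine exists_congr fun m => exists_congr fun n => ⟨fun h => ?_, fun h => ?_⟩
  · linear_combination h / 2
  · linear_combination 2 * h

theorem thetaEven_sub_thetaOdd_eq_zero_iff {τ : ℂ} (hτ : 0 < τ.im) (z : ℂ) :
    thetaEven τ z - thetaOdd τ z = 0 ↔ ∃ m n : ℤ, z = τ / 4 + m + n * (τ / 2) := by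
  rw [← jacobiTheta₂_half_add_half_eq hτ, jacobiTheta₂_eq_zero_iff (half_im_pos hτ)]
  refine exists_congr fun m => exists_congr fun n => ⟨fun h => ?_, fun h => ?_⟩
  · linear_combination h
  · linear_combination h

theorem jacobiTheta₂_ofReal_ne_zero {τ : ℂ} (hτ : 0 < τ.im) (x : ℝ) :
    jacobiTheta₂ x τ ≠ 0 := by
  rw [Ne, jacobiTheta₂_eq_zero_iff hτ]
  rintro ⟨m, n, h⟩
  have him := congrArg Complex.im h
  have h1 : (((1 + τ) / 2 + m + n * τ : ℂ)).im = (1 + 2 * n) * (τ.im / 2) := by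
    simp
    ring
  rw [h1, Complex.ofReal_im, eq_comm, mul_eq_zero] at him
  rcases him with h2 | h2
  · have : (1 + 2 * n : ℤ) = 0 := by exact_mod_cast h2
    omega
  · linarith

theorem thetaEven_zero_ne_zero {τ : ℂ} (hτ : 0 < τ.im) : thetaEven τ 0 ≠ 0 := by
  have h := jacobiTheta₂_ofReal_ne_zero (two_mul_im_pos hτ) 0
  simpa [thetaEven] using h

theorem thetaOdd_zero_ne_zero {τ : ℂ} (hτ : 0 < τ.im) : thetaOdd τ 0 ≠ 0 := by
  rw [Ne, thetaOdd_eq_zero_iff hτ]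
  rintro ⟨m, n, h⟩
  have him := congrArg Complex.im h
  have hre := congrArg Complex.re h
  have h1 : ((1 / 4 + m / 2 + n * τ : ℂ)).im = n * τ.im := by simp
  rw [h1, Complex.zero_im, eq_comm, mul_eq_zero, or_iff_left hτ.ne'] at him
  have h2 : ((1 / 4 + m / 2 + n * τ : ℂ)).re = 1 / 4 + m / 2 := by
    simp [him]
  rw [h2, Complex.zero_re] at hre
  have : (1 + 2 * m : ℤ) = 0 := by
    have : (1 + 2 * m : ℝ) = 0 := by linarith
    exact_mod_cast this
  omega

/-- By the addition formula the difference equals θ(0)²θ(1/2)², and theta has no real zero. It is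
the denominator in the duplication formulas. -/
theorem thetaEven_pow_four_sub_ne_zero {τ : ℂ} (hτ : 0 < τ.im) :
    thetaEven τ 0 ^ 4 - thetaOdd τ 0 ^ 4 ≠ 0 := by
  have h1 := jacobiTheta₂_add_mul_sub hτ 0 0
  have h2 := jacobiTheta₂_add_mul_sub hτ (0 + 1 / 2) 0
  rw [thetaEven_add_half, thetaOdd_add_half] at h2
  have h3 := jacobiTheta₂_ofReal_ne_zero hτ 0
  have h4 := jacobiTheta₂_ofReal_ne_zero hτ (1 / 2)
  simp only [add_zero, sub_zero, zero_add] at h1 h2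
  push_cast at h3 h4
  have : thetaEven τ 0 ^ 4 - thetaOdd τ 0 ^ 4 =
      (jacobiTheta₂ 0 τ * jacobiTheta₂ 0 τ) * (jacobiTheta₂ (1 / 2) τ * jacobiTheta₂ (1 / 2) τ) := by
    rw [h1, h2]
    ring
  rw [this]
  exact mul_ne_zero (mul_ne_zero h3 h3) (mul_ne_zero h4 h4)

/-! ### Duplication formulas. -/

theorem thetaEven_add_mul_sub {τ : ℂ} (hτ : 0 < τ.im) (x y : ℂ) :
    thetaEven τ (x + y) * thetaEven τ (x - y) =
      thetaEven (2 * τ) (2 * x) * thetaEven (2 * τ) (2 * y) +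
        thetaOdd (2 * τ) (2 * x) * thetaOdd (2 * τ) (2 * y) := by
  rw [← jacobiTheta₂_add_mul_sub (two_mul_im_pos hτ), thetaEven, thetaEven, mul_add, mul_sub]

/-- This is the addition formula at 2τ translated by its half period, which exchanges the two parts.
-/
theorem thetaOdd_add_mul_sub {τ : ℂ} (hτ : 0 < τ.im) (x y : ℂ) :
    thetaOdd τ (x + y) * thetaOdd τ (x - y) =
      thetaOdd (2 * τ) (2 * x) * thetaEven (2 * τ) (2 * y) +
        thetaEven (2 * τ) (2 * x) * thetaOdd (2 * τ) (2 * y) := by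
  have h := jacobiTheta₂_add_mul_sub (two_mul_im_pos hτ) (2 * x + 2 * τ / 2) (2 * y)
  rw [thetaEven_add_half_tau, thetaOdd_add_half_tau] at h
  have he : cexp (π * I * τ / 2 + 2 * π * I * (x + y)) * cexp (π * I * τ / 2 + 2 * π * I * (x - y)) *
      cexp (-(π * I * (2 * τ) / 2 + 2 * π * I * (2 * x))) = 1 := by
    rw [← Complex.exp_add, ← Complex.exp_add, ← Complex.exp_zero]
    ring_nf
  rw [thetaOdd, thetaOdd, show 2 * (x + y) + τ = 2 * x + 2 * τ / 2 + 2 * y by ring,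
    show 2 * (x - y) + τ = 2 * x + 2 * τ / 2 - 2 * y by ring]
  linear_combination cexp (π * I * τ / 2 + 2 * π * I * (x + y)) *
    cexp (π * I * τ / 2 + 2 * π * I * (x - y)) * h + (thetaOdd (2 * τ) (2 * x) *
      thetaEven (2 * τ) (2 * y) + thetaEven (2 * τ) (2 * x) * thetaOdd (2 * τ) (2 * y)) * he

/-- Duplication formula for the even part. -/
theorem thetaEven_two_mul {τ : ℂ} (hτ : 0 < τ.im) (x : ℂ) :
    (thetaEven τ 0 ^ 4 - thetaOdd τ 0 ^ 4) * (thetaEven τ (2 * x) * thetaEven τ 0) =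
      thetaEven τ 0 ^ 2 * (thetaEven τ x ^ 4 + thetaOdd τ x ^ 4) -
        2 * thetaOdd τ 0 ^ 2 * thetaEven τ x ^ 2 * thetaOdd τ x ^ 2 := by
  have h1 := thetaEven_add_mul_sub hτ x x
  have h2 := thetaEven_add_mul_sub hτ x 0
  have h3 := thetaOdd_add_mul_sub hτ x 0
  have h4 := thetaEven_add_mul_sub hτ 0 0
  have h5 := thetaOdd_add_mul_sub hτ 0 0
  simp only [add_zero, sub_zero, mul_zero, sub_self, ← two_mul x, ← sq] at h1 h2 h3 h4 h5
  -- All squares and products at τ become quadratic expressions in the parts at 2τ, after which the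
  -- formula is a polynomial identity.
  rw [show thetaEven τ 0 ^ 4 = (thetaEven τ 0 ^ 2) ^ 2 by ring,
    show thetaOdd τ 0 ^ 4 = (thetaOdd τ 0 ^ 2) ^ 2 by ring,
    show thetaEven τ x ^ 4 = (thetaEven τ x ^ 2) ^ 2 by ring,
    show thetaOdd τ x ^ 4 = (thetaOdd τ x ^ 2) ^ 2 by ring, h1, h2, h3, h4, h5]
  ring

/-- Duplication formula for the odd part. -/
theorem thetaOdd_two_mul {τ : ℂ} (hτ : 0 < τ.im) (x : ℂ) :
    (thetaEven τ 0 ^ 4 - thetaOdd τ 0 ^ 4) * (thetaOdd τ (2 * x) * thetaOdd τ 0) =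
      2 * thetaEven τ 0 ^ 2 * thetaEven τ x ^ 2 * thetaOdd τ x ^ 2 -
        thetaOdd τ 0 ^ 2 * (thetaEven τ x ^ 4 + thetaOdd τ x ^ 4) := by
  have h1 := thetaOdd_add_mul_sub hτ x x
  have h2 := thetaEven_add_mul_sub hτ x 0
  have h3 := thetaOdd_add_mul_sub hτ x 0
  have h4 := thetaEven_add_mul_sub hτ 0 0
  have h5 := thetaOdd_add_mul_sub hτ 0 0
  simp only [add_zero, sub_zero, mul_zero, sub_self, ← two_mul x, ← sq] at h1 h2 h3 h4 h5
  rw [show thetaEven τ 0 ^ 4 = (thetaEven τ 0 ^ 2) ^ 2 by ring,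
    show thetaOdd τ 0 ^ 4 = (thetaOdd τ 0 ^ 2) ^ 2 by ring,
    show thetaEven τ x ^ 4 = (thetaEven τ x ^ 2) ^ 2 by ring,
    show thetaOdd τ x ^ 4 = (thetaOdd τ x ^ 2) ^ 2 by ring, h1, h2, h3, h4, h5]
  ring

/-! ### Rigidity of the duplication equations. -/

theorem differentiable_dslope {f : ℂ → ℂ} (hf : Differentiable ℂ f) (c : ℂ) :
    Differentiable ℂ (dslope f c) :=
  differentiableOn_univ.mp ((Complex.differentiableOn_dslope univ_mem).mpr hf.differentiableOn)

/-- Evenness kills the linear term, so dividing twice by x leaves an entire function. Its value at 0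
encodes the second-order jet. -/
theorem exists_eq_one_add_sq_mul {f : ℂ → ℂ} (hf : Differentiable ℂ f) (heven : ∀ x, f (-x) = f x)
    (h0 : f 0 = 1) : ∃ k : ℂ → ℂ, Differentiable ℂ k ∧ ∀ x, f x = 1 + x ^ 2 * k x := by
  refine ⟨dslope (dslope f 0) 0, differentiable_dslope (differentiable_dslope hf 0) 0,
    fun x => ?_⟩
  have hd : deriv f 0 = 0 := by
    have h := deriv_comp_neg f 0
    rw [funext heven, neg_zero] at h
    linear_combination h / 2
  have h1 := sub_smul_dslope f 0 x
  have h2 := sub_smul_dslope (dslope f 0) 0 x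
  rw [dslope_same, hd] at h2
  simp only [sub_zero, smul_eq_mul, h0] at h1 h2
  linear_combination -h1 - x * h2

/-- An even solution of the duplication equations is determined by its second-order jet at `0`. -/
theorem duplication_unique {s t : ℂ} (hst : s - t = 1) {u v u' v' k l k' l' : ℂ → ℂ}
    (hk : Differentiable ℂ k) (hl : Differentiable ℂ l) (hk' : Differentiable ℂ k')
    (hl' : Differentiable ℂ l') (hu : ∀ x, u x = 1 + x ^ 2 * k x) (hv : ∀ x, v x = 1 + x ^ 2 * l x)
    (hu' : ∀ x, u' x = 1 + x ^ 2 * k' x) (hv' : ∀ x, v' x = 1 + x ^ 2 * l' x)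
    (du : ∀ x, u (2 * x) = s * u x ^ 4 + t * v x ^ 4 - 2 * t * u x ^ 2 * v x ^ 2)
    (dv : ∀ x, v (2 * x) = 2 * s * u x ^ 2 * v x ^ 2 - s * u x ^ 4 - t * v x ^ 4)
    (du' : ∀ x, u' (2 * x) = s * u' x ^ 4 + t * v' x ^ 4 - 2 * t * u' x ^ 2 * v' x ^ 2)
    (dv' : ∀ x, v' (2 * x) = 2 * s * u' x ^ 2 * v' x ^ 2 - s * u' x ^ 4 - t * v' x ^ 4)
    (hk0 : k 0 = k' 0) (hl0 : l 0 = l' 0) : u = u' ∧ v = v' := by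
  have cu : Continuous u := by rw [funext hu]; have := hk.continuous; fun_prop
  have cv : Continuous v := by rw [funext hv]; have := hl.continuous; fun_prop
  have cu' : Continuous u' := by rw [funext hu']; have := hk'.continuous; fun_prop
  have cv' : Continuous v' := by rw [funext hv']; have := hl'.continuous; fun_prop
  have u0 : u 0 = 1 := by simp [hu]
  have v0 : v 0 = 1 := by simp [hv]
  have u0' : u' 0 = 1 := by simp [hu']
  have v0' : v' 0 = 1 := by simp [hv']
  -- Subtracting the two duplication systems gives 4e(2x) = M(x)e(x), where M has entries P, Q, R, S
  -- and M(0) = 4·Id because s - t = 1.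
  set e : ℂ → ℂ × ℂ := fun x => (k x - k' x, l x - l' x) with he
  have hea : AnalyticAt ℂ e 0 := ((hk.sub hk').prodMk (hl.sub hl')).analyticAt 0
  set P : ℂ → ℂ := fun x => s * (u x + u' x) * (u x ^ 2 + u' x ^ 2) -
    2 * t * (u x + u' x) * v x ^ 2 with hP
  set Q : ℂ → ℂ := fun x => t * (v x + v' x) * (v x ^ 2 + v' x ^ 2) -
    2 * t * u' x ^ 2 * (v x + v' x) with hQ
  set R : ℂ → ℂ := fun x => 2 * s * (u x + u' x) * v x ^ 2 -
    s * (u x + u' x) * (u x ^ 2 + u' x ^ 2) with hR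
  set S : ℂ → ℂ := fun x => 2 * s * u' x ^ 2 * (v x + v' x) -
    t * (v x + v' x) * (v x ^ 2 + v' x ^ 2) with hS
  have cP : Continuous P := by rw [hP]; fun_prop
  have cQ : Continuous Q := by rw [hQ]; fun_prop
  have cR : Continuous R := by rw [hR]; fun_prop
  have cS : Continuous S := by rw [hS]; fun_prop
  have P0 : P 0 = 4 := by simp only [hP, u0, v0, u0']; linear_combination 4 * hst
  have Q0 : Q 0 = 0 := by simp only [hQ, v0, v0', u0']; ring
  have R0 : R 0 = 0 := by simp only [hR, u0, v0, u0']; ring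
  have S0 : S 0 = 4 := by simp only [hS, v0, v0', u0']; linear_combination 4 * hst
  have hrec : ∀ x, x ≠ 0 → 4 * (e (2 * x)).1 = P x * (e x).1 + Q x * (e x).2 ∧
      4 * (e (2 * x)).2 = R x * (e x).1 + S x * (e x).2 := by
    intro x hx
    have hx2 : x ^ 2 ≠ 0 := pow_ne_zero 2 hx
    have eu : u x - u' x = x ^ 2 * (e x).1 := by rw [hu, hu']; simp only [he]; ring
    have ev : v x - v' x = x ^ 2 * (e x).2 := by rw [hv, hv']; simp only [he]; ring
    have eu2 : u (2 * x) - u' (2 * x) = 4 * x ^ 2 * (e (2 * x)).1 := by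
      rw [hu, hu']; simp only [he]; ring
    have ev2 : v (2 * x) - v' (2 * x) = 4 * x ^ 2 * (e (2 * x)).2 := by
      rw [hv, hv']; simp only [he]; ring
    constructor <;> apply mul_left_cancel₀ hx2
    · simp only [hP, hQ]
      linear_combination -eu2 + du x - du' x + (s * (u x + u' x) * (u x ^ 2 + u' x ^ 2) -
        2 * t * (u x + u' x) * v x ^ 2) * eu + (t * (v x + v' x) * (v x ^ 2 + v' x ^ 2) -
        2 * t * u' x ^ 2 * (v x + v' x)) * ev
    · simp only [hR, hS]
      linear_combination -ev2 + dv x - dv' x + (2 * s * (u x + u' x) * v x ^ 2 -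
        s * (u x + u' x) * (u x ^ 2 + u' x ^ 2)) * eu + (2 * s * u' x ^ 2 * (v x + v' x) -
        t * (v x + v' x) * (v x ^ 2 + v' x ^ 2)) * ev
  by_cases hz : ∀ᶠ x in 𝓝 (0 : ℂ), e x = 0
  · have hkk : k = k' := eq_of_eventuallyEq_of_differentiable hk hk' (z₀ := 0) (by
      filter_upwards [hz] with x hx using sub_eq_zero.mp (congrArg Prod.fst hx))
    have hll : l = l' := eq_of_eventuallyEq_of_differentiable hl hl' (z₀ := 0) (by
      filter_upwards [hz] with x hx using sub_eq_zero.mp (congrArg Prod.snd hx))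
    subst hkk hll
    exact ⟨funext fun x => by rw [hu, hu'], funext fun x => by rw [hv, hv']⟩
  · exfalso
    -- If e has order n at 0 with leading coefficient g(0), the recursion gives 2ⁿ·g(0) = g(0), so n
    -- = 0; but equal jets mean e(0) = 0.
    obtain ⟨n, g, hg, hg0, hgn⟩ := hea.exists_eventuallyEq_pow_smul_nonzero_iff.mpr hz
    simp only [sub_zero] at hgn
    have hn : n ≠ 0 := by
      rintro rfl
      have := hgn.self_of_nhds
      simp only [pow_zero, one_smul] at this
      exact hg0 (by rw [← this]; simp [he, hk0, hl0])
    have t2 : Tendsto (fun x : ℂ => 2 * x) (𝓝 0) (𝓝 0) := by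
      have : Continuous fun x : ℂ => 2 * x := by fun_prop
      simpa using this.tendsto 0
    have hg2 : Tendsto (fun x => g (2 * x)) (𝓝 0) (𝓝 (g 0)) := hg.continuousAt.tendsto.comp t2
    have hev : ∀ᶠ x in 𝓝[≠] (0 : ℂ),
        (4 * 2 ^ n * (g (2 * x)).1 = P x * (g x).1 + Q x * (g x).2) ∧
        (4 * 2 ^ n * (g (2 * x)).2 = R x * (g x).1 + S x * (g x).2) := by
      filter_upwards [self_mem_nhdsWithin, nhdsWithin_le_nhds hgn,
        nhdsWithin_le_nhds (t2.eventually hgn)] with x hx h1 h2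
      have hx' : x ^ n ≠ 0 := pow_ne_zero n hx
      obtain ⟨r1, r2⟩ := hrec x hx
      rw [h1, h2] at r1 r2
      simp only [Prod.smul_fst, Prod.smul_snd, smul_eq_mul, mul_pow] at r1 r2
      constructor <;> apply mul_left_cancel₀ hx'
      · linear_combination r1
      · linear_combination r2
    have hfst : ∀ {f : ℂ → ℂ × ℂ}, Tendsto f (𝓝 0) (𝓝 (g 0)) →
        Tendsto (fun x => (f x).1) (𝓝[≠] 0) (𝓝 (g 0).1) := fun h =>
      ((continuous_fst.tendsto _).comp h).mono_left nhdsWithin_le_nhds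
    have hsnd : ∀ {f : ℂ → ℂ × ℂ}, Tendsto f (𝓝 0) (𝓝 (g 0)) →
        Tendsto (fun x => (f x).2) (𝓝[≠] 0) (𝓝 (g 0).2) := fun h =>
      ((continuous_snd.tendsto _).comp h).mono_left nhdsWithin_le_nhds
    have hc : ∀ {f : ℂ → ℂ}, Continuous f → Tendsto f (𝓝[≠] 0) (𝓝 (f 0)) := fun h =>
      (h.tendsto 0).mono_left nhdsWithin_le_nhds
    have l1 := tendsto_nhds_unique (((hfst hg2).const_mul (4 * 2 ^ n)).congr'
      (hev.mono fun x hx => hx.1)) (((hc cP).mul (hfst hg.continuousAt.tendsto)).add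
        ((hc cQ).mul (hsnd hg.continuousAt.tendsto)))
    have l2 := tendsto_nhds_unique (((hsnd hg2).const_mul (4 * 2 ^ n)).congr'
      (hev.mono fun x hx => hx.2)) (((hc cR).mul (hfst hg.continuousAt.tendsto)).add
        ((hc cS).mul (hsnd hg.continuousAt.tendsto)))
    rw [P0, Q0] at l1
    rw [R0, S0] at l2
    have hpow : (2 : ℂ) ^ n - 1 ≠ 0 := by
      have : (2 : ℕ) ^ n ≠ 1 := (Nat.one_lt_two_pow hn).ne'
      rw [sub_ne_zero]
      exact_mod_cast this
    refine hg0 (Prod.ext ?_ ?_)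
    · exact (mul_eq_zero.mp (by linear_combination l1 / 4 :
        ((2 : ℂ) ^ n - 1) * (g 0).1 = 0)).resolve_left hpow
    · exact (mul_eq_zero.mp (by linear_combination l2 / 4 :
        ((2 : ℂ) ^ n - 1) * (g 0).2 = 0)).resolve_left hpow

/-- The zero of the theta function at the half period is simple. -/
theorem deriv_jacobiTheta₂_halfPeriod_ne_zero {τ : ℂ} (hτ : 0 < τ.im) :
    deriv (fun x => jacobiTheta₂ (x + (1 + τ) / 2) τ) 0 ≠ 0 := by
  intro h0
  set g : ℂ → ℂ := fun x => jacobiTheta₂ (x + (1 + τ) / 2) τ with hg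
  have dg : Differentiable ℂ g :=
    (differentiable_jacobiTheta₂ hτ).comp (differentiable_id.add_const _)
  have g0 : g 0 = 0 := by simpa [hg] using jacobiTheta₂_halfPeriod hτ
  have dA := differentiable_thetaEven hτ
  have dB := differentiable_thetaOdd hτ
  -- At x = y the derivative of g(x+y)g(x-y) is g'(2y)g(0) + g(2y)g'(0). If it vanishes, so does the
  -- Wronskian of A and B, making them proportional, which the half shift excludes.
  have hW : ∀ y, thetaOdd τ y * deriv (thetaEven τ) y - thetaEven τ y * deriv (thetaOdd τ) y =
      0 * thetaEven τ y * thetaOdd τ y := by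
    intro y
    have h1 : HasDerivAt (fun x => g (x + y) * g (x - y)) 0 y := by
      have a1 := HasDerivAt.comp_add_const y y (dg (y + y)).hasDerivAt
      have a2 := HasDerivAt.comp_sub_const y y (dg (y - y)).hasDerivAt
      refine (a1.mul a2).congr_deriv ?_
      simp [g0, h0]
    have h2 : HasDerivAt (fun x => cexp (-(π * I * τ / 2 + 2 * π * I * x)) *
        (thetaOdd τ x * thetaEven τ y - thetaEven τ x * thetaOdd τ y))
        (cexp (-(π * I * τ / 2 + 2 * π * I * y)) *
          (deriv (thetaOdd τ) y * thetaEven τ y - deriv (thetaEven τ) y * thetaOdd τ y)) y := by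
      have b1 : DifferentiableAt ℂ (fun x : ℂ => cexp (-(π * I * τ / 2 + 2 * π * I * x))) y := by
        fun_prop
      have b2 := ((dB y).hasDerivAt.mul_const (thetaEven τ y)).sub
        ((dA y).hasDerivAt.mul_const (thetaOdd τ y))
      refine (b1.hasDerivAt.mul b2).congr_deriv ?_
      simp only [Pi.sub_apply]
      ring
    rw [← funext fun x => jacobiTheta₂_add_mul_sub_halfPeriod hτ x y] at h2
    have h3 := h1.unique h2
    rw [eq_comm, mul_eq_zero, or_iff_right (Complex.exp_ne_zero _)] at h3
    linear_combination -h3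
  obtain ⟨C, hC⟩ := exists_eq_const_mul_exp_mul dA dB 0 hW (thetaOdd_zero_ne_zero hτ)
  have c1 := hC 0
  have c2 := hC (0 + 1 / 2)
  rw [thetaEven_add_half, thetaOdd_add_half] at c2
  simp only [zero_mul, Complex.exp_zero, mul_one] at c1 c2
  exact thetaEven_zero_ne_zero hτ (by linear_combination (c1 + c2) / 2)

/-- The normalised even and odd parts have a different second-order jet at `0`. -/
theorem theta_jets_ne {τ : ℂ} (hτ : 0 < τ.im) {k l : ℂ → ℂ} (hk : Differentiable ℂ k)
    (hl : Differentiable ℂ l) (hA : ∀ x, thetaEven τ x / thetaEven τ 0 = 1 + x ^ 2 * k x)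
    (hB : ∀ x, thetaOdd τ x / thetaOdd τ 0 = 1 + x ^ 2 * l x) : k 0 ≠ l 0 := by
  intro hkl
  have A0 := thetaEven_zero_ne_zero hτ
  have B0 := thetaOdd_zero_ne_zero hτ
  set g : ℂ → ℂ := fun x => jacobiTheta₂ (x + (1 + τ) / 2) τ with hg
  have dg : Differentiable ℂ g :=
    (differentiable_jacobiTheta₂ hτ).comp (differentiable_id.add_const _)
  have g0 : g 0 = 0 := by simpa [hg] using jacobiTheta₂_halfPeriod hτ
  set F : ℂ → ℂ := fun x => cexp (-(π * I * τ / 2 + 2 * π * I * x)) *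
    (thetaEven τ 0 * thetaOdd τ 0 * (l x - k x)) with hF
  have cF : Continuous F := by
    have := hk.continuous
    have := hl.continuous
    fun_prop
  -- The square of theta at the half period is an exponential times x²(l - k). Equal jets would make
  -- the zero of theta more than simple.
  have hev : ∀ x ∈ ({0}ᶜ : Set ℂ), dslope g 0 x ^ 2 = F x := by
    intro x hx
    have h1 := sub_smul_dslope g 0 x
    have h2 := jacobiTheta₂_add_mul_sub_halfPeriod hτ x 0
    have hA' := hA x
    have hB' := hB x
    rw [div_eq_iff A0] at hA'
    rw [div_eq_iff B0] at hB'
    simp only [sub_zero, g0, smul_eq_mul, add_zero] at h1 h2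
    change g x * g x = _ at h2
    rw [← h1, hA', hB'] at h2
    apply mul_left_cancel₀ (pow_ne_zero 2 hx : x ^ 2 ≠ 0)
    simp only [hF]
    linear_combination h2
  have c1 : Tendsto (fun x => dslope g 0 x ^ 2) (𝓝[≠] 0) (𝓝 (dslope g 0 0 ^ 2)) :=
    (((differentiable_dslope dg 0).continuous.pow 2).tendsto 0).mono_left nhdsWithin_le_nhds
  have c2 : Tendsto F (𝓝[≠] 0) (𝓝 (F 0)) := (cF.tendsto 0).mono_left nhdsWithin_le_nhds
  have h := tendsto_nhds_unique (c1.congr' (eventually_mem_nhdsWithin.mono hev)) c2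
  rw [dslope_same] at h
  simp only [hF, hkl, sub_self, mul_zero] at h
  exact deriv_jacobiTheta₂_halfPeriod_ne_zero hτ (pow_eq_zero_iff two_ne_zero |>.mp h)

/-- Duplication formulas for the even and odd parts normalised at `0`. -/
theorem theta_normalized_two_mul {τ : ℂ} (hτ : 0 < τ.im) {s t : ℂ}
    (hs : s * (thetaEven τ 0 ^ 4 - thetaOdd τ 0 ^ 4) = thetaEven τ 0 ^ 4)
    (ht : t * (thetaEven τ 0 ^ 4 - thetaOdd τ 0 ^ 4) = thetaOdd τ 0 ^ 4) {u v : ℂ → ℂ}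
    (hu : ∀ x, thetaEven τ x = thetaEven τ 0 * u x) (hv : ∀ x, thetaOdd τ x = thetaOdd τ 0 * v x)
    (x : ℂ) :
    u (2 * x) = s * u x ^ 4 + t * v x ^ 4 - 2 * t * u x ^ 2 * v x ^ 2 ∧
      v (2 * x) = 2 * s * u x ^ 2 * v x ^ 2 - s * u x ^ 4 - t * v x ^ 4 := by
  have A0 := thetaEven_zero_ne_zero hτ
  have B0 := thetaOdd_zero_ne_zero hτ
  have D0 := thetaEven_pow_four_sub_ne_zero hτ
  have h1 := thetaEven_two_mul hτ x
  have h2 := thetaOdd_two_mul hτ x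
  rw [hu (2 * x), hu x, hv x] at h1
  rw [hv (2 * x), hu x, hv x] at h2
  constructor
  · apply mul_left_cancel₀ (mul_ne_zero D0 (pow_ne_zero 2 A0))
    linear_combination h1 - thetaEven τ 0 ^ 2 * u x ^ 4 * hs - thetaEven τ 0 ^ 2 * v x ^ 4 * ht +
      2 * thetaEven τ 0 ^ 2 * u x ^ 2 * v x ^ 2 * ht
  · apply mul_left_cancel₀ (mul_ne_zero D0 (pow_ne_zero 2 B0))
    linear_combination h2 - 2 * thetaOdd τ 0 ^ 2 * u x ^ 2 * v x ^ 2 * hs +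
      thetaOdd τ 0 ^ 2 * u x ^ 4 * hs + thetaOdd τ 0 ^ 2 * v x ^ 4 * ht

/-! ### From proportional theta constants to Γ(4). -/

/-- Proportional theta constants force the theta functions to agree up to a dilation and a Gaussian
factor. -/
theorem exists_theta_similarity {τ τ' κ : ℂ} (hτ : 0 < τ.im) (hτ' : 0 < τ'.im)
    (hA : thetaEven τ 0 = κ * thetaEven τ' 0) (hB : thetaOdd τ 0 = κ * thetaOdd τ' 0) :
    ∃ c ρ : ℂ, c ≠ 0 ∧ ∀ x, thetaEven τ x = κ * cexp (ρ * x ^ 2) * thetaEven τ' (c * x) ∧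
      thetaOdd τ x = κ * cexp (ρ * x ^ 2) * thetaOdd τ' (c * x) := by
  have A0 := thetaEven_zero_ne_zero hτ
  have B0 := thetaOdd_zero_ne_zero hτ
  have A0' := thetaEven_zero_ne_zero hτ'
  have B0' := thetaOdd_zero_ne_zero hτ'
  have D0 := thetaEven_pow_four_sub_ne_zero hτ
  have κ0 : κ ≠ 0 := by rintro rfl; simp [hA] at A0
  have hnorm : ∀ {σ : ℂ}, 0 < σ.im →
      (∃ k : ℂ → ℂ, Differentiable ℂ k ∧ ∀ x, thetaEven σ x / thetaEven σ 0 = 1 + x ^ 2 * k x) ∧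
      ∃ l : ℂ → ℂ, Differentiable ℂ l ∧ ∀ x, thetaOdd σ x / thetaOdd σ 0 = 1 + x ^ 2 * l x := by
    intro σ hσ
    exact ⟨exists_eq_one_add_sq_mul ((differentiable_thetaEven hσ).div_const _)
        (fun x => by rw [thetaEven_neg]) (div_self (thetaEven_zero_ne_zero hσ)),
      exists_eq_one_add_sq_mul ((differentiable_thetaOdd hσ).div_const _)
        (fun x => by rw [thetaOdd_neg]) (div_self (thetaOdd_zero_ne_zero hσ))⟩
  obtain ⟨⟨k, dk, hk⟩, l, dl, hl⟩ := hnorm hτ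
  obtain ⟨⟨k', dk', hk'⟩, l', dl', hl'⟩ := hnorm hτ'
  have hne : k 0 - l 0 ≠ 0 := sub_ne_zero.mpr (theta_jets_ne hτ dk dl hk hl)
  have hne' : k' 0 - l' 0 ≠ 0 := sub_ne_zero.mpr (theta_jets_ne hτ' dk' dl' hk' hl')
  -- Two unknowns match two jets: k(0) = ρ + c²k'(0) and l(0) = ρ + c²l'(0). Distinctness of the
  -- jets makes this solvable with c ≠ 0.
  obtain ⟨c, hc⟩ := IsAlgClosed.exists_pow_nat_eq ((k 0 - l 0) / (k' 0 - l' 0)) two_pos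
  rw [eq_div_iff hne'] at hc
  have hc0 : c ≠ 0 := by rintro rfl; exact hne (by rw [← hc]; ring)
  set ρ : ℂ := k 0 - c ^ 2 * k' 0 with hρ
  set m : ℂ → ℂ := fun x => ρ * dslope cexp 0 (ρ * x ^ 2) with hm
  have dm : Differentiable ℂ m := by
    have := differentiable_dslope Complex.differentiable_exp 0
    exact (this.comp (by fun_prop : Differentiable ℂ fun x : ℂ => ρ * x ^ 2)).const_mul ρ
  have m0 : m 0 = ρ := by simp [hm]
  have hexp : ∀ x : ℂ, cexp (ρ * x ^ 2) = 1 + x ^ 2 * m x := by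
    intro x
    have h := sub_smul_dslope cexp 0 (ρ * x ^ 2)
    simp only [sub_zero, smul_eq_mul, Complex.exp_zero] at h
    simp only [hm]
    linear_combination -h
  set s : ℂ := thetaEven τ 0 ^ 4 / (thetaEven τ 0 ^ 4 - thetaOdd τ 0 ^ 4) with hs
  set t : ℂ := thetaOdd τ 0 ^ 4 / (thetaEven τ 0 ^ 4 - thetaOdd τ 0 ^ 4) with ht
  have hs1 : s * (thetaEven τ 0 ^ 4 - thetaOdd τ 0 ^ 4) = thetaEven τ 0 ^ 4 :=
    div_mul_cancel₀ _ D0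
  have ht1 : t * (thetaEven τ 0 ^ 4 - thetaOdd τ 0 ^ 4) = thetaOdd τ 0 ^ 4 :=
    div_mul_cancel₀ _ D0
  have hst : s - t = 1 := by rw [hs, ht, ← sub_div, div_self D0]
  -- The coefficients s and t are homogeneous of degree 0 in the theta constants, so τ and τ' share
  -- them.
  have hs2 : s * (thetaEven τ' 0 ^ 4 - thetaOdd τ' 0 ^ 4) = thetaEven τ' 0 ^ 4 := by
    rw [hA, hB] at hs1
    apply mul_left_cancel₀ (pow_ne_zero 4 κ0)
    linear_combination hs1
  have ht2 : t * (thetaEven τ' 0 ^ 4 - thetaOdd τ' 0 ^ 4) = thetaOdd τ' 0 ^ 4 := by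
    rw [hA, hB] at ht1
    apply mul_left_cancel₀ (pow_ne_zero 4 κ0)
    linear_combination ht1
  have dup := theta_normalized_two_mul hτ hs1 ht1 (u := fun x => thetaEven τ x / thetaEven τ 0)
    (v := fun x => thetaOdd τ x / thetaOdd τ 0) (fun x => by field_simp) (fun x => by field_simp)
  have dup' := theta_normalized_two_mul hτ' hs2 ht2
    (u := fun x => thetaEven τ' x / thetaEven τ' 0)
    (v := fun x => thetaOdd τ' x / thetaOdd τ' 0) (fun x => by field_simp) (fun x => by field_simp)
  have hE2 : ∀ x : ℂ, cexp (ρ * (2 * x) ^ 2) = cexp (ρ * x ^ 2) ^ 4 := by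
    intro x
    rw [← Complex.exp_nat_mul]
    push_cast
    ring_nf
  have hmul : ∀ {j : ℂ → ℂ}, Differentiable ℂ j →
      Differentiable ℂ (fun x => m x + c ^ 2 * j (c * x) + x ^ 2 * m x * (c ^ 2 * j (c * x))) := by
    intro j hj
    have : Differentiable ℂ fun x => j (c * x) := hj.comp (differentiable_id.const_mul c)
    fun_prop
  obtain ⟨e1, e2⟩ := duplication_unique hst dk dl (hmul dk') (hmul dl') hk hl
    (u' := fun x => cexp (ρ * x ^ 2) * (thetaEven τ' (c * x) / thetaEven τ' 0))
    (v' := fun x => cexp (ρ * x ^ 2) * (thetaOdd τ' (c * x) / thetaOdd τ' 0))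
    (fun x => by rw [hk', hexp]; ring) (fun x => by rw [hl', hexp]; ring)
    (fun x => (dup x).1) (fun x => (dup x).2)
    (fun x => by
      have h := (dup' (c * x)).1
      rw [hE2, show c * (2 * x) = 2 * (c * x) by ring, h]
      ring)
    (fun x => by
      have h := (dup' (c * x)).2
      rw [hE2, show c * (2 * x) = 2 * (c * x) by ring, h]
      ring)
    (by simp only [mul_zero, m0, hρ]; ring)
    (by simp only [mul_zero, m0, hρ]; linear_combination hc)
  refine ⟨c, ρ, hc0, fun x => ⟨?_, ?_⟩⟩
  · have h := congrFun e1 x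
    simp only [hA] at h
    field_simp at h
    rw [h, mul_comm x c]
  · have h := congrFun e2 x
    simp only [hB] at h
    field_simp at h
    rw [h, mul_comm x c]

/-- A similarity between two theta functions comes from an integral matrix that is diagonal
modulo `4`. -/
theorem exists_matrix_of_similarity {τ τ' κ c ρ : ℂ} (hτ : 0 < τ.im) (hτ' : 0 < τ'.im)
    (hκ : κ ≠ 0)
    (h : ∀ x, thetaEven τ x = κ * cexp (ρ * x ^ 2) * thetaEven τ' (c * x) ∧
      thetaOdd τ x = κ * cexp (ρ * x ^ 2) * thetaOdd τ' (c * x)) :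
    ∃ p q m n : ℤ, 4 ∣ m ∧ 4 ∣ q ∧ Odd p ∧ Odd n ∧ c = m * τ' + n ∧ c * τ = p * τ' + q ∧
      τ.im * normSq c = (p * n - q * m : ℤ) * τ'.im := by
  have hne : ∀ x : ℂ, κ * cexp (ρ * x ^ 2) ≠ 0 := fun x => mul_ne_zero hκ (Complex.exp_ne_zero _)
  -- A similarity carries zeros to zeros: 1/4 is a zero of B and τ/4 a zero of A - B, so c/4 and
  -- cτ/4 are zeros of the same functions at τ'.
  obtain ⟨n, m, h1⟩ : ∃ n m : ℤ, c * (1 / 4) = 1 / 4 + n / 2 + m * τ' := by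
    rw [← thetaOdd_eq_zero_iff hτ']
    have h0 := (thetaOdd_eq_zero_iff hτ (1 / 4)).mpr ⟨0, 0, by simp⟩
    rw [(h _).2] at h0
    exact (mul_eq_zero.mp h0).resolve_left (hne _)
  obtain ⟨q, p, h2⟩ : ∃ q p : ℤ, c * (τ / 4) = τ' / 4 + q + p * (τ' / 2) := by
    rw [← thetaEven_sub_thetaOdd_eq_zero_iff hτ']
    have h0 := (thetaEven_sub_thetaOdd_eq_zero_iff hτ (τ / 4)).mpr ⟨0, 0, by simp⟩
    rw [(h _).1, (h _).2, ← mul_sub] at h0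
    exact (mul_eq_zero.mp h0).resolve_left (hne _)
  have e1 : c = ((4 * m : ℤ) : ℂ) * τ' + ((2 * n + 1 : ℤ) : ℂ) := by
    push_cast
    linear_combination 4 * h1
  have e2 : c * τ = ((2 * p + 1 : ℤ) : ℂ) * τ' + ((4 * q : ℤ) : ℂ) := by
    push_cast
    linear_combination 4 * h2
  refine ⟨2 * p + 1, 4 * q, 4 * m, 2 * n + 1, ⟨m, rfl⟩, ⟨q, rfl⟩, ⟨p, rfl⟩, ⟨n, rfl⟩, e1, e2, ?_⟩
  -- Im(cτ·c̄), computed from the two lattice expressions, brings in the determinant.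
  have e3 : (c * τ * (starRingEnd ℂ) c).im = τ.im * normSq c := by
    rw [show c * τ * (starRingEnd ℂ) c = τ * (c * (starRingEnd ℂ) c) by ring, Complex.mul_conj,
      Complex.mul_im]
    simp
  rw [← e3, e2, e1]
  simp only [map_add, map_mul, map_intCast, Complex.mul_im, Complex.add_im,
    Complex.add_re, Complex.mul_re, Complex.intCast_re, Complex.intCast_im, Complex.conj_re,
    Complex.conj_im]
  push_cast
  ring

/-- Parameters with proportional theta constants are equivalent under the principal congruence
subgroup of level `4`. -/
theorem exists_gamma_four_of_proportional {τ τ' κ : ℂ} (hτ : 0 < τ.im) (hτ' : 0 < τ'.im)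
    (hA : thetaEven τ 0 = κ * thetaEven τ' 0) (hB : thetaOdd τ 0 = κ * thetaOdd τ' 0) :
    ∃ p q m n : ℤ, p * n - q * m = 1 ∧ 4 ∣ m ∧ 4 ∣ q ∧ n % 4 = 1 ∧
      τ * (m * τ' + n) = p * τ' + q := by
  have A0 := thetaEven_zero_ne_zero hτ
  have κ0 : κ ≠ 0 := by rintro rfl; simp [hA] at A0
  obtain ⟨c, ρ, hc, h⟩ := exists_theta_similarity hτ hτ' hA hB
  have hinv : ∀ x, thetaEven τ' x = κ⁻¹ * cexp (-(ρ / c ^ 2) * x ^ 2) * thetaEven τ (c⁻¹ * x) ∧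
      thetaOdd τ' x = κ⁻¹ * cexp (-(ρ / c ^ 2) * x ^ 2) * thetaOdd τ (c⁻¹ * x) := by
    intro x
    obtain ⟨h1, h2⟩ := h (c⁻¹ * x)
    have hx : c * (c⁻¹ * x) = x := by field_simp
    have hE : cexp (-(ρ / c ^ 2) * x ^ 2) * cexp (ρ * (c⁻¹ * x) ^ 2) = 1 := by
      rw [← Complex.exp_add, ← Complex.exp_zero]
      congr 1
      field_simp
      ring
    rw [hx] at h1 h2
    rw [h1, h2]
    have hκ : κ⁻¹ * κ = 1 := inv_mul_cancel₀ κ0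
    constructor
    · linear_combination -thetaEven τ' x * hE - thetaEven τ' x * cexp (-(ρ / c ^ 2) * x ^ 2) *
        cexp (ρ * (c⁻¹ * x) ^ 2) * hκ
    · linear_combination -thetaOdd τ' x * hE - thetaOdd τ' x * cexp (-(ρ / c ^ 2) * x ^ 2) *
        cexp (ρ * (c⁻¹ * x) ^ 2) * hκ
  obtain ⟨p, q, m, n, hm, hq, hp, hn, e1, e2, e3⟩ := exists_matrix_of_similarity hτ hτ' κ0 h
  obtain ⟨p', q', m', n', -, -, -, -, -, -, e3'⟩ :=
    exists_matrix_of_similarity hτ' hτ (inv_ne_zero κ0) hinv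
  have hN : 0 < normSq c := normSq_pos.mpr hc
  -- The similarity and its inverse have integer determinants with product 1, and the sign is
  -- positive since both points lie in the upper half-plane.
  have hdet : p * n - q * m = 1 := by
    rw [map_inv₀] at e3'
    have h1 : ((p * n - q * m : ℤ) : ℝ) * (p' * n' - q' * m' : ℤ) = 1 := by
      have h2 : τ'.im = (p' * n' - q' * m' : ℤ) * τ.im * normSq c := by
        rw [← e3']
        field_simp
      have h3 : τ.im * normSq c * (((p * n - q * m : ℤ) : ℝ) * (p' * n' - q' * m' : ℤ)) =
          τ.im * normSq c * 1 := by
        rw [mul_one]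
        conv_rhs => rw [e3, h2]
        ring
      exact mul_left_cancel₀ (by positivity) h3
    have h4 : (p * n - q * m) * (p' * n' - q' * m') = 1 := by exact_mod_cast h1
    have h5 : 0 < p * n - q * m := by
      have : (0 : ℝ) < (p * n - q * m : ℤ) := by
        by_contra! hle
        have h6 : 0 < τ.im * normSq c := by positivity
        rw [e3] at h6
        nlinarith
      exact_mod_cast this
    rcases Int.eq_one_or_neg_one_of_mul_eq_one h4 with h | h <;> omega
  rcases hn with ⟨n, rfl⟩
  -- The matrix may be negated, so the odd lower-right entry can be taken to be 1 mod 4.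
  rcases Int.even_or_odd' n with ⟨r, rfl | rfl⟩
  · exact ⟨p, q, m, 2 * (2 * r) + 1, hdet, hm, hq, by omega, by
      rw [← e1]; linear_combination e2⟩
  · refine ⟨-p, -q, -m, -(2 * (2 * r + 1) + 1), by linear_combination hdet, hm.neg_right,
      hq.neg_right, by omega, ?_⟩
    push_cast at e1 ⊢
    linear_combination -e2 + τ * e1

/-! ### The principal square root -/

theorem Complex.sqrt_pow_two (w : ℂ) : w.sqrt ^ 2 = w := by
  simp [Complex.sqrt]

theorem Complex.sqrt_re_nonneg (w : ℂ) : 0 ≤ w.sqrt.re := by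
  rw [Complex.sqrt, cpow_inv_two_re]
  positivity

theorem Complex.sqrt_eq_of_sq {z w : ℂ} (h : z ^ 2 = w) (hz : 0 < z.re) : w.sqrt = z := by
  have h1 : w.sqrt ^ 2 = z ^ 2 := by rw [Complex.sqrt_pow_two, h]
  rcases sq_eq_sq_iff_eq_or_eq_neg.mp h1 with h2 | h2
  · exact h2
  · have h3 := Complex.sqrt_re_nonneg w
    rw [h2, neg_re] at h3
    linarith

theorem Complex.two_mul_sqrt_re_mul_im (w : ℂ) : 2 * (w.sqrt.re * w.sqrt.im) = w.im := by
  have h := congrArg Complex.im (Complex.sqrt_pow_two w)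
  rw [sq, mul_im] at h
  linarith

theorem Complex.sqrt_of_im_pos {w : ℂ} (h : 0 < w.im) : 0 < w.sqrt.re ∧ 0 < w.sqrt.im := by
  have h1 := Complex.two_mul_sqrt_re_mul_im w
  have h2 := Complex.sqrt_re_nonneg w
  have h3 : 0 < w.sqrt.re * w.sqrt.im := by linarith
  have h4 := pos_of_mul_pos_right h3 h2
  exact ⟨pos_of_mul_pos_left h3 h4.le, h4⟩

theorem Complex.sqrt_of_im_neg {w : ℂ} (h : w.im < 0) : 0 < w.sqrt.re ∧ w.sqrt.im < 0 := by
  have h1 := Complex.two_mul_sqrt_re_mul_im w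
  have h2 := Complex.sqrt_re_nonneg w
  have h3 : w.sqrt.re * w.sqrt.im < 0 := by linarith
  constructor
  · rcases h2.lt_or_eq with h4 | h4
    · exact h4
    · rw [← h4] at h3
      simp at h3
  · by_contra! h5
    have := mul_nonneg h2 h5
    linarith

theorem Complex.sqrt_conj {w : ℂ} (h : w.im ≠ 0) :
    (starRingEnd ℂ w).sqrt = starRingEnd ℂ w.sqrt := by
  refine Complex.sqrt_eq_of_sq (by rw [← map_pow, Complex.sqrt_pow_two]) ?_
  rw [conj_re]
  rcases h.lt_or_gt with h | h
  · exact (Complex.sqrt_of_im_neg h).1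
  · exact (Complex.sqrt_of_im_pos h).1

/-- The two roots lie in the open first and fourth quadrants, so their product stays in the right
half-plane. In the next two lemmas the half-plane of xy locates the product of the roots: no sign
for two upper points, a minus sign for two lower ones. -/
theorem Complex.sqrt_mul_of_opposite {x y : ℂ} (hx : 0 < x.im) (hy : y.im < 0) :
    (x * y).sqrt = x.sqrt * y.sqrt := by
  refine Complex.sqrt_eq_of_sq (by rw [mul_pow, Complex.sqrt_pow_two, Complex.sqrt_pow_two]) ?_
  obtain ⟨h1, h2⟩ := Complex.sqrt_of_im_pos hx
  obtain ⟨h3, h4⟩ := Complex.sqrt_of_im_neg hy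
  rw [mul_re]
  nlinarith [mul_pos h1 h3]

theorem Complex.sqrt_mul_of_im_pos {x y : ℂ} (hx : 0 < x.im) (hy : 0 < y.im)
    (hxy : 0 < (x * y).im) : (x * y).sqrt = x.sqrt * y.sqrt := by
  have hsq : (x.sqrt * y.sqrt) ^ 2 = x * y := by
    rw [mul_pow, Complex.sqrt_pow_two, Complex.sqrt_pow_two]
  refine Complex.sqrt_eq_of_sq hsq ?_
  obtain ⟨h1, h2⟩ := Complex.sqrt_of_im_pos hx
  obtain ⟨h3, h4⟩ := Complex.sqrt_of_im_pos hy
  have h5 : 0 < (x.sqrt * y.sqrt).im := by rw [mul_im]; positivity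
  rw [← hsq, sq, mul_im] at hxy
  nlinarith

theorem Complex.sqrt_mul_of_im_neg {x y : ℂ} (hx : x.im < 0) (hy : y.im < 0)
    (hxy : 0 < (x * y).im) : (x * y).sqrt = -(x.sqrt * y.sqrt) := by
  have hsq : (x.sqrt * y.sqrt) ^ 2 = x * y := by
    rw [mul_pow, Complex.sqrt_pow_two, Complex.sqrt_pow_two]
  refine Complex.sqrt_eq_of_sq (by rw [neg_sq, hsq]) ?_
  obtain ⟨h1, h2⟩ := Complex.sqrt_of_im_neg hx
  obtain ⟨h3, h4⟩ := Complex.sqrt_of_im_neg hy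
  have h5 : (x.sqrt * y.sqrt).im < 0 := by
    rw [mul_im]
    nlinarith [mul_pos h1 (neg_pos.mpr h4), mul_pos h3 (neg_pos.mpr h2)]
  rw [← hsq, sq, mul_im] at hxy
  rw [neg_re]
  nlinarith

/-! ### Generators -/

theorem jacobiTheta₂_add_int (z τ : ℂ) (n : ℤ) : jacobiTheta₂ (z + n) τ = jacobiTheta₂ z τ := by
  have h : Function.Periodic (fun u : ℂ => jacobiTheta₂ u τ) 1 := fun u => jacobiTheta₂_add_left u τ
  simpa using h.int_mul n z

theorem jacobiTheta₂_add_two_mul_int (z τ : ℂ) (n : ℤ) :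
    jacobiTheta₂ z (τ + n * 2) = jacobiTheta₂ z τ := by
  have h : Function.Periodic (fun u : ℂ => jacobiTheta₂ z u) 2 := fun u => jacobiTheta₂_add_right z u
  exact h.int_mul n τ

theorem thetaEven_add_int (τ : ℂ) (n : ℤ) : thetaEven (τ + n) 0 = thetaEven τ 0 := by
  rw [thetaEven, thetaEven, ← jacobiTheta₂_add_two_mul_int (2 * 0) (2 * τ) n]
  ring_nf

theorem thetaOdd_add_int (τ : ℂ) (n : ℤ) : thetaOdd (τ + n) 0 = I ^ n * thetaOdd τ 0 := by
  have hI : (I : ℂ) ^ n = cexp (n * (π / 2 * I)) := by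
    rw [Complex.exp_int_mul, Complex.exp_pi_div_two_mul_I]
  rw [hI, thetaOdd, thetaOdd, show 2 * (τ + n) = 2 * τ + n * 2 by ring, jacobiTheta₂_add_two_mul_int,
    show 2 * 0 + (τ + n) = 2 * 0 + τ + n by ring, jacobiTheta₂_add_int, ← mul_assoc,
    ← Complex.exp_add]
  ring_nf

theorem neg_one_div_im_pos {τ : ℂ} (hτ : 0 < τ.im) : 0 < (-1 / τ).im := by
  have h0 : 0 < normSq τ := normSq_pos.mpr (by rintro rfl; simp at hτ)
  rw [neg_div, neg_im, one_div, inv_im]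
  rw [neg_div, neg_neg]
  positivity

theorem theta_inversion {τ : ℂ} (hτ : 0 < τ.im) :
    thetaEven τ 0 = 1 / (-I * (2 * τ)).sqrt * (thetaEven (-1 / τ) 0 + thetaOdd (-1 / τ) 0) ∧
      thetaOdd τ 0 = 1 / (-I * (2 * τ)).sqrt * (thetaEven (-1 / τ) 0 - thetaOdd (-1 / τ) 0) := by
  have h0 : τ ≠ 0 := by rintro rfl; simp at hτ
  have h1 := neg_one_div_im_pos hτ
  have h2 : -1 / (2 * τ) = (-1 / τ) / 2 := by field_simp
  constructor
  · rw [thetaEven, mul_zero, jacobiTheta₂_functional_equation, h2, zero_div,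
      jacobiTheta₂_half_eq h1, Complex.sqrt]
    simp
  · rw [thetaOdd, jacobiTheta₂_functional_equation, h2,
      show (2 * 0 + τ) / (2 * τ) = 0 + 1 / 2 by field_simp; ring,
      jacobiTheta₂_half_add_half_eq h1, Complex.sqrt]
    have he : cexp (π * I * τ / 2 + 2 * π * I * 0) * cexp (-π * I * (2 * 0 + τ) ^ 2 / (2 * τ)) = 1 := by
      rw [← Complex.exp_add, ← Complex.exp_zero]
      congr 1
      field_simp
      ring
    rw [one_div (2 : ℂ)]
    linear_combination (1 / (-I * (2 * τ)) ^ (2⁻¹ : ℂ)) *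
      (thetaEven (-1 / τ) 0 - thetaOdd (-1 / τ) 0) * he

theorem moebius_im {τ : ℂ} (a b c d : ℝ) :
    ((a * τ + b) / (c * τ + d)).im = (a * d - b * c) * τ.im / normSq (c * τ + d) := by
  rw [div_im]
  simp only [add_im, add_re, mul_im, mul_re, ofReal_re, ofReal_im]
  ring

theorem div_mul_add_one_im_pos {τ : ℂ} (hτ : 0 < τ.im) (n : ℤ) :
    (4 * n * τ + 1 ≠ 0) ∧ 0 < (τ / (4 * n * τ + 1)).im := by
  have h0 : 4 * n * τ + 1 ≠ 0 := by
    intro h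
    have h1 := congrArg Complex.im h
    have h2 := congrArg Complex.re h
    simp only [add_im, mul_im, one_im, zero_im, add_re, mul_re, one_re, zero_re, intCast_re,
      intCast_im, re_ofNat, im_ofNat] at h1 h2
    have h3 : (4 * n : ℝ) * τ.im = 0 := by linarith
    rw [mul_eq_zero, or_iff_left hτ.ne'] at h3
    have h4 : (n : ℝ) = 0 := by linarith
    simp [h4] at h2
  refine ⟨h0, ?_⟩
  have h := moebius_im (τ := τ) 1 0 (4 * n) 1
  push_cast at h
  simp only [one_mul, add_zero, mul_one, zero_mul, sub_zero] at h
  rw [h]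
  exact div_pos hτ (normSq_pos.mpr h0)

/-- The inversion conjugates this map to a translation by -4n, which acts trivially on the theta
constants because I⁴ = 1. -/
theorem theta_lower_unipotent {τ : ℂ} (hτ : 0 < τ.im) (n : ℤ) :
    thetaEven (τ / (4 * n * τ + 1)) 0 = (4 * n * τ + 1).sqrt * thetaEven τ 0 ∧
      thetaOdd (τ / (4 * n * τ + 1)) 0 = (4 * n * τ + 1).sqrt * thetaOdd τ 0 := by
  obtain ⟨h0, hpos⟩ := div_mul_add_one_im_pos hτ n
  have hτ0 : τ ≠ 0 := by rintro rfl; simp at hτ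
  set σ := τ / (4 * n * τ + 1) with hσ
  have hσ0 : σ ≠ 0 := div_ne_zero hτ0 h0
  obtain ⟨a1, a2⟩ := theta_inversion hτ
  obtain ⟨b1, b2⟩ := theta_inversion hpos
  have hinv : -1 / σ = -1 / τ + ((-4 * n : ℤ) : ℂ) := by
    rw [hσ]
    push_cast
    field_simp
    ring
  have hI : (I : ℂ) ^ (-4 * n : ℤ) = 1 := by
    rw [zpow_mul, show (I : ℂ) ^ (-4 : ℤ) = 1 by
      rw [zpow_neg, show (4 : ℤ) = ((4 : ℕ) : ℤ) by rfl, zpow_natCast, I_pow_four, inv_one], one_zpow]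
  rw [hinv, thetaEven_add_int, thetaOdd_add_int, hI, one_mul] at b1 b2
  set r := (-I * (2 * τ)).sqrt with hr
  set r' := (-I * (2 * σ)).sqrt with hr'
  have hrsq : r ^ 2 = -I * (2 * τ) := Complex.sqrt_pow_two _
  have hrsq' : r' ^ 2 = -I * (2 * σ) := Complex.sqrt_pow_two _
  have hr0 : r ≠ 0 := by
    intro h
    rw [h] at hrsq
    simp [hτ0] at hrsq
  have hr0' : r' ≠ 0 := by
    intro h
    rw [h] at hrsq'
    simp [hσ0] at hrsq'
  -- Both roots lie in the sector |arg| < π/4, so their quotient has positive real part and is the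
  -- principal root.
  have hsector : ∀ {w ζ : ℂ}, 0 < ζ.im → w ^ 2 = -I * (2 * ζ) → 0 ≤ w.re → |w.im| < w.re := by
    intro w ζ hζ hw hre
    have h := congrArg Complex.re hw
    rw [sq, mul_re] at h
    simp at h
    exact abs_lt_of_sq_lt_sq (by nlinarith) hre
  have s1 := hsector hτ hrsq (Complex.sqrt_re_nonneg _)
  have s2 := hsector hpos hrsq' (Complex.sqrt_re_nonneg _)
  have hsqrt : (4 * n * τ + 1).sqrt = r / r' := by
    refine Complex.sqrt_eq_of_sq ?_ ?_
    · rw [div_pow, hrsq, hrsq', hσ]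
      have := I_ne_zero
      field_simp
    · rw [div_re, ← add_div]
      refine div_pos ?_ (normSq_pos.mpr hr0')
      rw [abs_lt] at s1 s2
      nlinarith
  rw [hsqrt, b1, b2, a1, a2]
  constructor <;> field_simp

theorem thetaEven_conj (τ : ℂ) :
    thetaEven (-starRingEnd ℂ τ) 0 = starRingEnd ℂ (thetaEven τ 0) := by
  rw [thetaEven, thetaEven, jacobiTheta₂_conj]
  simp [map_ofNat]

theorem thetaOdd_conj (τ : ℂ) :
    thetaOdd (-starRingEnd ℂ τ) 0 = starRingEnd ℂ (thetaOdd τ 0) := by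
  rw [thetaOdd, thetaOdd, map_mul, jacobiTheta₂_conj, ← Complex.exp_conj,
    ← jacobiTheta₂_neg_left]
  simp [map_ofNat]

/-! ### Jacobi symbols -/

/-- By reciprocity: for m ≡ 3 mod 4 the factor (-1|m) = -1 is compensated by the reciprocity signs,
as x and y are then opposite mod 4. -/
theorem jacobiSym_eq_of_dvd_add_of_odd {m x y : ℕ} (hm : Odd m) (hx : Odd x) (hy : Odd y)
    (h : 4 * m ∣ x + y) : J(m | x) = J(m | y) := by
  have hxy : J(x | m) = J(-1 | m) * J(y | m) := by
    rw [← jacobiSym.mul_left]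
    have hd : (m : ℤ) ∣ ((x + y : ℕ) : ℤ) := by exact_mod_cast (dvd_mul_left m 4).trans h
    refine jacobiSym.mod_left' (Int.ModEq.symm (Int.modEq_iff_dvd.mpr ?_))
    convert hd using 1
    push_cast
    ring
  have h4 : 4 ∣ x + y := (dvd_mul_right 4 m).trans h
  have hx2 : x % 2 = 1 := Nat.odd_iff.mp hx
  have hy2 : y % 2 = 1 := Nat.odd_iff.mp hy
  have hm2 : m % 2 = 1 := Nat.odd_iff.mp hm
  rw [← jacobiSym.quadratic_reciprocity_if hm2 hx2, ← jacobiSym.quadratic_reciprocity_if hm2 hy2,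
    hxy, jacobiSym.at_neg_one hm]
  rcases Nat.odd_mod_four_iff.mp hm2 with h1 | h3
  · rw [ZMod.χ₄_nat_one_mod_four h1]
    simp [h1]
  · rw [ZMod.χ₄_nat_three_mod_four h3]
    rcases Nat.odd_mod_four_iff.mp hx2 with k1 | k3
    · have : y % 4 = 3 := by omega
      simp [h3, k1, this]
    · have : y % 4 = 1 := by omega
      simp [h3, k3, this]

/-- Factors 2 are stripped one at a time: each leaves 8 ∣ x + y, and (2|·) takes the same value at
opposite residues mod 8. -/
theorem jacobiSym_eq_of_dvd_add {m x y : ℕ} (hm0 : m ≠ 0) (hx : Odd x) (hy : Odd y)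
    (h : 4 * m ∣ x + y) : J(m | x) = J(m | y) := by
  induction m using Nat.strong_induction_on with
  | _ m ih =>
    rcases Nat.even_or_odd' m with ⟨r, rfl | rfl⟩
    · have hr := ih r (by omega) (by omega) (Dvd.dvd.trans ⟨2, by ring⟩ h)
      have h8 : 8 ∣ x + y := Dvd.dvd.trans ⟨r, by ring⟩ h
      have hx2 := Nat.odd_iff.mp hx
      have hy2 := Nat.odd_iff.mp hy
      push_cast
      rw [jacobiSym.mul_left, jacobiSym.mul_left, hr, jacobiSym.at_two hx, jacobiSym.at_two hy,
        ZMod.χ₈_nat_eq_if_mod_eight, ZMod.χ₈_nat_eq_if_mod_eight]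
      congr 1
      rw [if_neg (by omega : ¬x % 2 = 0), if_neg (by omega : ¬y % 2 = 0)]
      have : (x % 8 = 1 ∨ x % 8 = 7) ↔ (y % 8 = 1 ∨ y % 8 = 7) := by omega
      simp only [this]
    · exact jacobiSym_eq_of_dvd_add_of_odd ⟨r, rfl⟩ hx hy h

theorem jacobiSym_natAbs_eq_of_dvd_sub {c δ δ' : ℤ} (hc : 0 < c) (h4 : 4 ∣ c) (hδ : Odd δ)
    (hδ' : Odd δ') (h : c ∣ δ - δ') : J(c | δ.natAbs) = J(c | δ'.natAbs) := by
  obtain ⟨m, rfl⟩ := h4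
  lift m to ℕ using by omega
  have o1 : Odd δ.natAbs := Int.natAbs_odd.mpr hδ
  have o2 : Odd δ'.natAbs := Int.natAbs_odd.mpr hδ'
  rw [jacobiSym.mul_left, jacobiSym.mul_left, jacobiSym.at_four o1, jacobiSym.at_four o2]
  congr 1
  have same : ∀ {x y : ℕ}, Odd x → Odd y → (4 * m : ℤ) ∣ x - y → J(m | x) = J(m | y) := by
    intro x y hx hy hxy
    rw [jacobiSym.mod_right' m hx, jacobiSym.mod_right' m hy]
    congr 1
    exact (Nat.modEq_iff_dvd.mpr (by push_cast; exact (dvd_sub_comm.mp hxy)))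
  have opp : ∀ {x y : ℕ}, Odd x → Odd y → (4 * m : ℤ) ∣ x + y → J(m | x) = J(m | y) := by
    intro x y hx hy hxy
    exact jacobiSym_eq_of_dvd_add (by omega) hx hy (by exact_mod_cast hxy)
  rcases Int.natAbs_eq δ with e1 | e1 <;> rcases Int.natAbs_eq δ' with e2 | e2 <;>
    rw [e1, e2] at h
  · exact same o1 o2 h
  · exact opp o1 o2 (by simpa using h)
  · obtain ⟨k, hk⟩ := h
    exact opp o1 o2 ⟨-k, by linear_combination -hk⟩
  · obtain ⟨k, hk⟩ := h
    exact same o1 o2 ⟨-k, by linear_combination -hk⟩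

theorem jacobiSym_abs_of_one_mod_four {n : ℕ} (hn : n % 4 = 1) (c : ℤ) : J(|c| | n) = J(c | n) := by
  rcases abs_choice c with h | h <;> rw [h]
  have : Odd n := Nat.odd_iff.mpr (by omega)
  rw [← neg_one_mul, jacobiSym.mul_left, jacobiSym.at_neg_one this, ZMod.χ₄_nat_one_mod_four hn,
    one_mul]

theorem jacobiSym_neg_of_three_mod_four {n : ℕ} (hn : n % 4 = 3) (c : ℤ) :
    J(-c | n) = -J(c | n) := by
  have : Odd n := Nat.odd_iff.mpr (by omega)
  rw [← neg_one_mul, jacobiSym.mul_left, jacobiSym.at_neg_one this, ZMod.χ₄_nat_three_mod_four hn]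
  ring

/-! ### Transformation law of the theta constants. -/

/-- The theta constants transform under `τ ↦ (α τ + β) / (c τ + δ)` with multiplier
`(|c| / |δ|) √(c τ + δ)`, up to a fourth root of unity for the odd part. -/
def ThetaTransforms (α β c δ : ℤ) : Prop :=
  ∀ τ : ℂ, 0 < τ.im →
    thetaEven ((α * τ + β) / (c * τ + δ)) 0 =
      (J(|c| | δ.natAbs) : ℂ) * (c * τ + δ).sqrt * thetaEven τ 0 ∧
    thetaOdd ((α * τ + β) / (c * τ + δ)) 0 =
      I ^ β * ((J(|c| | δ.natAbs) : ℂ) * (c * τ + δ).sqrt * thetaOdd τ 0)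

theorem intCast_mul_add_intCast_im (c δ : ℤ) (τ : ℂ) : ((c : ℂ) * τ + δ).im = c * τ.im := by
  simp

theorem I_zpow_eq_of_four_dvd {m n : ℤ} (h : 4 ∣ m - n) : (I : ℂ) ^ m = I ^ n := by
  obtain ⟨k, hk⟩ := h
  rw [show m = n + 4 * k by omega, zpow_add₀ I_ne_zero, zpow_mul,
    show (I : ℂ) ^ (4 : ℤ) = 1 by
      rw [show (4 : ℤ) = ((4 : ℕ) : ℤ) by rfl, zpow_natCast, I_pow_four], one_zpow, mul_one]

/-- Reflection τ ↦ -τ̄ conjugates theta constants and reverses the sign of c, so the descent needs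
only c > 0. -/
theorem ThetaTransforms.of_conj {α β c δ : ℤ} (hc : c ≠ 0) (h : ThetaTransforms α (-β) (-c) δ) :
    ThetaTransforms α β c δ := by
  intro τ hτ
  have him : ((c : ℂ) * τ + δ).im ≠ 0 := by
    rw [intCast_mul_add_intCast_im]
    exact mul_ne_zero (Int.cast_ne_zero.mpr hc) hτ.ne'
  obtain ⟨h1, h2⟩ := h (-starRingEnd ℂ τ) (by simpa using hτ)
  have e1 : ((-c : ℤ) : ℂ) * (-starRingEnd ℂ τ) + δ = starRingEnd ℂ (c * τ + δ) := by
    push_cast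
    simp
  have e2 : ((α : ℂ) * (-starRingEnd ℂ τ) + ((-β : ℤ) : ℂ)) =
      -starRingEnd ℂ (α * τ + β) := by
    push_cast
    simp
    ring
  rw [e1, e2, neg_div, ← map_div₀, Complex.sqrt_conj him, abs_neg] at h1 h2
  rw [thetaEven_conj, thetaEven_conj] at h1
  rw [thetaOdd_conj, thetaOdd_conj] at h2
  have hI : (I : ℂ) ^ (-β) = starRingEnd ℂ (I ^ β) := by
    rw [map_zpow₀, conj_I, zpow_neg, ← inv_zpow, inv_I]
  constructor
  · apply (starRingEnd ℂ).injective
    rw [h1]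
    simp
  · apply (starRingEnd ℂ).injective
    rw [h2, hI]
    simp

/-- Splits off a translation by k on the right. The condition on α is what makes the powers of I
multiply correctly. -/
theorem ThetaTransforms.of_shift {α β c δ : ℤ} (k : ℤ) (hα : 4 ∣ α - 1)
    (hJ : J(|c| | (δ - k * c).natAbs) = J(|c| | δ.natAbs))
    (h : ThetaTransforms α (β - k * α) c (δ - k * c)) : ThetaTransforms α β c δ := by
  intro τ hτ
  obtain ⟨h1, h2⟩ := h (τ + k) (by simpa using hτ)
  have e1 : (c : ℂ) * (τ + k) + ((δ - k * c : ℤ) : ℂ) = c * τ + δ := by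
    push_cast
    ring
  have e2 : (α : ℂ) * (τ + k) + ((β - k * α : ℤ) : ℂ) = α * τ + β := by
    push_cast
    ring
  rw [e1, e2, hJ] at h1 h2
  rw [thetaEven_add_int] at h1
  rw [thetaOdd_add_int] at h2
  refine ⟨h1, ?_⟩
  have hI : (I : ℂ) ^ β = I ^ (β - k * α) * I ^ k := by
    rw [← zpow_add₀ I_ne_zero]
    apply I_zpow_eq_of_four_dvd
    obtain ⟨r, hr⟩ := hα
    exact ⟨k * r, by linear_combination k * hr⟩
  rw [h2, hI]
  ring

/-- Splits off τ ↦ τ/(4nτ+1) on the right; `hne` is the cocycle identity required of the multiplier.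
-/
theorem ThetaTransforms.of_lower {α β c δ : ℤ} (n : ℤ)
    (hne : ∀ τ : ℂ, 0 < τ.im → (J(|c - 4 * n * δ| | δ.natAbs) : ℂ) *
      (((c - 4 * n * δ : ℤ) : ℂ) * (τ / (4 * n * τ + 1)) + δ).sqrt * (4 * n * τ + 1).sqrt =
        (J(|c| | δ.natAbs) : ℂ) * (c * τ + δ).sqrt)
    (h : ThetaTransforms (α - 4 * n * β) β (c - 4 * n * δ) δ) : ThetaTransforms α β c δ := by
  intro τ hτ
  obtain ⟨h0, hpos⟩ := div_mul_add_one_im_pos hτ n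
  obtain ⟨h1, h2⟩ := h _ hpos
  obtain ⟨u1, u2⟩ := theta_lower_unipotent hτ n
  rw [u1] at h1
  rw [u2] at h2
  have e1 : ((c - 4 * n * δ : ℤ) : ℂ) * (τ / (4 * n * τ + 1)) + δ =
      (c * τ + δ) / (4 * n * τ + 1) := by
    push_cast
    field_simp
    ring
  have e2 : ((α - 4 * n * β : ℤ) : ℂ) * (τ / (4 * n * τ + 1)) + β =
      (α * τ + β) / (4 * n * τ + 1) := by
    push_cast
    field_simp
    ring
  have e3 : (α * τ + β) / (4 * n * τ + 1) / ((c * τ + δ) / (4 * n * τ + 1)) =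
      ((α : ℂ) * τ + β) / (c * τ + δ) := div_div_div_cancel_right₀ h0 _ _
  have e4 := hne τ hτ
  rw [e2, e1, e3] at h1 h2
  rw [e1] at e4
  rw [h1, h2, ← e4]
  constructor <;> ring

theorem lower_factor_mul {τ : ℂ} (hτ : 0 < τ.im) (c δ n : ℤ) :
    (((c - 4 * n * δ : ℤ) : ℂ) * (τ / (4 * n * τ + 1)) + δ) * (4 * n * τ + 1) = c * τ + δ := by
  have h0 := (div_mul_add_one_im_pos hτ n).1
  push_cast
  field_simp
  ring

/-- Neither factor changes sign: (-1|δ) = 1, and the square root is multiplicative because cτ+δ and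
4τ+1 are in the upper half-plane. -/
theorem thetaTransforms_of_pos_of_pos {α β c δ : ℤ} (hc : 0 < c) (hδ : 0 < δ) (hδ4 : δ % 4 = 1)
    (hdet : α * δ - β * c = 1)
    (h : ThetaTransforms (α - 4 * 1 * β) β (c - 4 * 1 * δ) δ) : ThetaTransforms α β c δ := by
  refine ThetaTransforms.of_lower 1 (fun τ hτ => ?_) h
  have hJ : J(|c - 4 * 1 * δ| | δ.natAbs) = J(|c| | δ.natAbs) := by
    have hn : δ.natAbs % 4 = 1 := by omega
    rw [jacobiSym_abs_of_one_mod_four hn, jacobiSym_abs_of_one_mod_four hn]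
    refine jacobiSym.mod_left' (Int.modEq_iff_dvd.mpr ?_)
    rw [Int.natCast_natAbs, abs_of_pos hδ]
    exact ⟨4, by ring⟩
  rw [hJ, mul_assoc]
  congr 1
  have hfac := lower_factor_mul hτ c δ 1
  have hpos := (div_mul_add_one_im_pos hτ 1).2
  have hy : 0 < (4 * (1 : ℤ) * τ + 1 : ℂ).im := by simpa using hτ
  have hx : (((c - 4 * 1 * δ : ℤ) : ℂ) * (τ / (4 * (1 : ℤ) * τ + 1)) + δ).im =
      (c - 4 * 1 * δ : ℤ) * (τ / (4 * (1 : ℤ) * τ + 1)).im := intCast_mul_add_intCast_im _ _ _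
  have hw : 0 < ((c : ℂ) * τ + δ).im := by
    rw [intCast_mul_add_intCast_im]
    have : (0 : ℝ) < c := by exact_mod_cast hc
    positivity
  rcases lt_trichotomy (c - 4 * 1 * δ) 0 with hs | hs | hs
  · have hsgn : ((c - 4 * 1 * δ : ℤ) : ℝ) < 0 := by exact_mod_cast hs
    rw [← hfac, mul_comm, mul_comm (_ + _) (4 * _ * τ + 1), Complex.sqrt_mul_of_opposite hy]
    rw [hx]
    exact mul_neg_of_neg_of_pos hsgn hpos
  · have hδ1 : δ = 1 := by
      have h1 : (α - 4 * β) * δ = 1 := by linear_combination hdet + β * hs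
      rcases Int.eq_one_or_neg_one_of_mul_eq_one' h1 with h | h <;> omega
    rw [← hfac, hs, hδ1]
    simp
  · have hsgn : (0 : ℝ) < (c - 4 * 1 * δ : ℤ) := by exact_mod_cast hs
    rw [← hfac] at hw ⊢
    rw [Complex.sqrt_mul_of_im_pos _ hy hw]
    rw [hx]
    exact mul_pos hsgn hpos

/-- Here |δ| ≡ 3 mod 4. When c + 4δ < 0, both the Jacobi symbol and the square root contribute -1,
and these cancel. -/
theorem thetaTransforms_of_pos_of_neg {α β c δ : ℤ} (hc : 0 < c) (hδ : δ < 0) (hδ4 : δ % 4 = 1)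
    (hdet : α * δ - β * c = 1)
    (h : ThetaTransforms (α - 4 * (-1) * β) β (c - 4 * (-1) * δ) δ) : ThetaTransforms α β c δ := by
  refine ThetaTransforms.of_lower (-1) (fun τ hτ => ?_) h
  have hn : δ.natAbs % 4 = 3 := by omega
  have hJ : J(c - 4 * (-1) * δ | δ.natAbs) = J(c | δ.natAbs) := by
    refine jacobiSym.mod_left' (Int.modEq_iff_dvd.mpr ?_)
    rw [Int.natCast_natAbs, abs_of_neg hδ]
    exact ⟨4, by ring⟩
  have hfac := lower_factor_mul hτ c δ (-1)
  have hpos := (div_mul_add_one_im_pos hτ (-1)).2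
  have hy : (4 * (-1 : ℤ) * τ + 1 : ℂ).im < 0 := by simpa using hτ
  have hx : (((c - 4 * (-1) * δ : ℤ) : ℂ) * (τ / (4 * (-1 : ℤ) * τ + 1)) + δ).im =
      (c - 4 * (-1) * δ : ℤ) * (τ / (4 * (-1 : ℤ) * τ + 1)).im := intCast_mul_add_intCast_im _ _ _
  have hw : 0 < ((c : ℂ) * τ + δ).im := by
    rw [intCast_mul_add_intCast_im]
    have : (0 : ℝ) < c := by exact_mod_cast hc
    positivity
  rw [abs_of_pos hc, mul_assoc]
  rcases lt_trichotomy (c - 4 * (-1) * δ) 0 with hs | hs | hs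
  · have hsgn : ((c - 4 * (-1) * δ : ℤ) : ℝ) < 0 := by exact_mod_cast hs
    rw [abs_of_neg hs, jacobiSym_neg_of_three_mod_four hn, hJ]
    rw [← hfac] at hw ⊢
    rw [Complex.sqrt_mul_of_im_neg _ hy hw]
    · push_cast
      ring
    · rw [hx]
      exact mul_neg_of_neg_of_pos hsgn hpos
  · have h1 : (α + 4 * β) * δ = 1 := by linear_combination hdet + β * hs
    rcases Int.eq_one_or_neg_one_of_mul_eq_one' h1 with h | h <;> omega
  · have hsgn : (0 : ℝ) < (c - 4 * (-1) * δ : ℤ) := by exact_mod_cast hs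
    rw [abs_of_pos hs, hJ, ← hfac, Complex.sqrt_mul_of_opposite _ hy]
    rw [hx]
    exact mul_pos hsgn hpos

/-- The transformation law of the theta constants under matrices congruent to an upper unipotent
matrix modulo `4`. -/
theorem thetaTransforms {α β c δ : ℤ} (hdet : α * δ - β * c = 1) (hc : 4 ∣ c) (hδ : δ % 4 = 1) :
    ThetaTransforms α β c δ := by
  induction hN : c.natAbs using Nat.strong_induction_on generalizing α β c δ with
  | _ N ih =>
    have main : ∀ {α β c δ : ℤ}, α * δ - β * c = 1 → 4 ∣ c → δ % 4 = 1 → c.natAbs = N → 0 < c →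
        ThetaTransforms α β c δ := by
      intro α β c δ hdet hc hδ hN hpos
      obtain ⟨m, rfl⟩ := hc
      have hα : 4 ∣ α - 1 := by
        obtain ⟨r, hr⟩ : ∃ r, δ = 4 * r + 1 := ⟨δ / 4, by omega⟩
        exact ⟨β * m - α * r, by rw [hr] at hdet; linear_combination hdet⟩
      -- Rounding δ/c to a nearest integer gives |δ'| ≤ c/2. As δ' is odd and c/2 = 2m even, the
      -- inequality is strict, so |c - 4|δ'|| < c and the descent proceeds.
      obtain ⟨k, hk1, hk2⟩ : ∃ k : ℤ, -(2 * m) ≤ δ - k * (4 * m) ∧ δ - k * (4 * m) ≤ 2 * m := by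
        refine ⟨(δ + 2 * m) / (4 * m), ?_, ?_⟩
        · have := Int.mul_ediv_self_le (x := δ + 2 * m) (k := 4 * m) hpos.ne'
          linarith
        · have := Int.lt_mul_ediv_self_add (x := δ + 2 * m) hpos
          linarith
      have hδ' : (δ - k * (4 * m)) % 4 = 1 := by
        rw [show δ - k * (4 * m) = δ - 4 * (k * m) by ring]
        omega
      refine ThetaTransforms.of_shift k hα ?_ ?_
      · rw [abs_of_pos hpos]
        refine jacobiSym_natAbs_eq_of_dvd_sub hpos ⟨m, rfl⟩ (Int.odd_iff.mpr (by omega))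
          (Int.odd_iff.mpr (by omega)) ⟨-k, by ring⟩
      · have hdet' : α * (δ - k * (4 * m)) - (β - k * α) * (4 * m) = 1 := by
          linear_combination hdet
        generalize δ - k * (4 * m) = δ' at *
        generalize β - k * α = β' at *
        rcases lt_trichotomy δ' 0 with hs | hs | hs
        · refine thetaTransforms_of_pos_of_neg hpos hs hδ' hdet' (ih _ ?_ ?_ ?_ hδ' rfl)
          · omega
          · linear_combination hdet'
          · exact ⟨m + δ', by ring⟩
        · omega
        · refine thetaTransforms_of_pos_of_pos hpos hs hδ' hdet' (ih _ ?_ ?_ ?_ hδ' rfl)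
          · omega
          · linear_combination hdet'
          · exact ⟨m - δ', by ring⟩
    rcases lt_trichotomy c 0 with hs | rfl | hs
    · refine ThetaTransforms.of_conj hs.ne (main ?_ hc.neg_right hδ ?_ (by omega))
      · linear_combination hdet
      · rwa [Int.natAbs_neg]
    · have hδ1 : δ = 1 := by
        have h1 : α * δ = 1 := by linear_combination hdet
        rcases Int.eq_one_or_neg_one_of_mul_eq_one' h1 with h | h <;> omega
      subst hδ1
      have hα1 : α = 1 := by linarith
      subst hα1
      intro τ hτ
      have e := thetaEven_add_int τ β
      have o := thetaOdd_add_int τ β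
      simp [e, o]
    · exact main hdet hc hδ hN hs

/-! ### Criticality in terms of theta constants -/

theorem ZMod.sum_val_eq_sum_range (d : ℕ) [NeZero d] (g : ℕ → ℂ) :
    ∑ s : ZMod d, g s.val = ∑ s ∈ Finset.range d, g s := by
  obtain ⟨n, rfl⟩ := Nat.exists_eq_succ_of_ne_zero (NeZero.ne d)
  exact Fin.sum_univ_eq_sum_range g (n + 1)

/-- The distribution relation at τ/2 with base points 0 and 1/2 gives the sum and the difference.
Oddness of d enters as d/2 ≡ 1/2 mod 1. -/
theorem sum_thetaEven_thetaOdd {d : ℕ} [NeZero d] (hd : Odd d) {τ : ℂ} (hτ : 0 < τ.im) :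
    ∑ s ∈ Finset.range d, thetaEven τ (s / d) = d * thetaEven ((d : ℂ) ^ 2 * τ) 0 ∧
      ∑ s ∈ Finset.range d, thetaOdd τ (s / d) = d * thetaOdd ((d : ℂ) ^ 2 * τ) 0 := by
  obtain ⟨k, hk⟩ := hd
  have hdτ := natCast_sq_mul_im_pos hτ d
  have h1 := sum_jacobiTheta₂_add_div (half_im_pos hτ) d 0
  have h2 := sum_jacobiTheta₂_add_div (half_im_pos hτ) d (1 / 2)
  rw [← mul_div_assoc, mul_zero, jacobiTheta₂_half_eq hdτ] at h1
  rw [← mul_div_assoc ((d : ℂ) ^ 2), show (d : ℂ) * (1 / 2) = 0 + 1 / 2 + (k : ℤ) by rw [hk]; push_cast; ring,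
    jacobiTheta₂_add_int, jacobiTheta₂_half_add_half_eq hdτ] at h2
  simp only [zero_add, jacobiTheta₂_half_eq hτ, Finset.sum_add_distrib] at h1
  simp only [add_comm (1 / 2 : ℂ), jacobiTheta₂_half_add_half_eq hτ, Finset.sum_sub_distrib] at h2
  constructor
  · linear_combination (h1 + h2) / 2
  · linear_combination (h1 - h2) / 2

theorem sum_thetaSample {d : ℕ} [NeZero d] (hd : Odd d) {τ : ℂ} (hτ : 0 < τ.im) (z : ℂ)
    (t : ZMod d) :
    ∑ s : ZMod d, thetaSample d τ z s * thetaSample d τ z (2 • t - s) =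
      thetaEven τ (z + t.val / d) * (d * thetaEven ((d : ℂ) ^ 2 * τ) 0) +
        thetaOdd τ (z + t.val / d) * (d * thetaOdd ((d : ℂ) ^ 2 * τ) 0) := by
  obtain ⟨hA, hB⟩ := sum_thetaEven_thetaOdd hd hτ
  -- The substitution s ↦ t + s centres the convolution, turning its terms into products θ(w +
  -- s/d)θ(w - s/d).
  rw [← hA, ← hB, Finset.mul_sum, Finset.mul_sum, ← Finset.sum_add_distrib,
    ← ZMod.sum_val_eq_sum_range d fun s => thetaEven τ (z + t.val / d) * thetaEven τ (s / d) +
      thetaOdd τ (z + t.val / d) * thetaOdd τ (s / d), ← Equiv.sum_comp (Equiv.addLeft t)]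
  refine Finset.sum_congr rfl fun s _ => ?_
  have e1 : Equiv.addLeft t s = (((t.val : ℤ) + s.val : ℤ) : ZMod d) := by
    push_cast
    simp
  have e2 : 2 • t - Equiv.addLeft t s = (((t.val : ℤ) - s.val : ℤ) : ZMod d) := by
    push_cast
    simp [two_mul]
  rw [e2, e1, thetaSample_intCast, thetaSample_intCast, ← jacobiTheta₂_add_mul_sub hτ]
  push_cast
  ring_nf

/-- Two zeros of theta differ by a lattice point, which 1/d is not when d > 1. For d = 1 criticality
fails at the half period. -/
theorem thetaSample_ne_zero {d : ℕ} [NeZero d] (hd : 1 < d) {τ : ℂ} (hτ : 0 < τ.im) (z : ℂ) :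
    thetaSample d τ z ≠ 0 := by
  intro h
  have h0 := congrFun h ((0 : ℤ) : ZMod d)
  have h1 := congrFun h ((1 : ℤ) : ZMod d)
  rw [thetaSample_intCast, Pi.zero_apply, jacobiTheta₂_eq_zero_iff hτ] at h0 h1
  obtain ⟨m, n, h0⟩ := h0
  obtain ⟨m', n', h1⟩ := h1
  have hd0 : (d : ℂ) ≠ 0 := Nat.cast_ne_zero.mpr (by omega)
  have h2 : ((d * (m' - m) - 1 : ℤ) : ℂ) + ((d * (n' - n) : ℤ) : ℂ) * τ = 0 := by
    have h3 : (1 : ℂ) / d = (m' - m) + (n' - n) * τ := by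
      push_cast at h0 h1
      linear_combination h1 - h0
    rw [div_eq_iff hd0] at h3
    push_cast
    linear_combination -h3
  have him := congrArg Complex.im h2
  rw [add_comm, intCast_mul_add_intCast_im, Complex.zero_im, mul_eq_zero,
    or_iff_left hτ.ne'] at him
  have him' : (d * (n' - n) : ℤ) = 0 := by exact_mod_cast him
  rw [him'] at h2
  have h4 : (d * (m' - m) - 1 : ℤ) = 0 := by
    have : ((d * (m' - m) - 1 : ℤ) : ℂ) = 0 := by simpa using h2
    exact_mod_cast this
  have h5 : (d : ℤ) ∣ 1 := ⟨m' - m, by linarith⟩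
  have := Int.le_of_dvd one_pos h5
  omega

theorem IsThetaCritical.one_lt {lam τ : ℂ} {d : ℕ} [NeZero d] (hτ : 0 < τ.im)
    (h : IsThetaCritical lam d τ) : 1 < d := by
  by_contra hd
  obtain rfl : d = 1 := by
    have := NeZero.ne d
    omega
  refine (h ((1 + τ) / 2)).1 (funext fun l => ?_)
  obtain rfl : l = ((0 : ℤ) : ZMod 1) := Subsingleton.elim _ _
  rw [thetaSample_intCast]
  simpa using jacobiTheta₂_halfPeriod hτ

theorem isThetaCritical_iff {d : ℕ} [NeZero d] (hd : Odd d) (hd1 : 1 < d) {τ : ℂ}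
    (hτ : 0 < τ.im) (lam : ℂ) :
    IsThetaCritical lam d τ ↔ d * thetaEven ((d : ℂ) ^ 2 * τ) 0 = lam * thetaEven τ 0 ∧
      d * thetaOdd ((d : ℂ) ^ 2 * τ) 0 = lam * thetaOdd τ 0 := by
  have hsq : ∀ w, jacobiTheta₂ w τ ^ 2 =
      thetaEven τ w * thetaEven τ 0 + thetaOdd τ w * thetaOdd τ 0 := by
    intro w
    rw [← jacobiTheta₂_add_mul_sub hτ, add_zero, sub_zero, sq]
  constructor
  · intro h
    have key : ∀ z, thetaEven τ z * (d * thetaEven ((d : ℂ) ^ 2 * τ) 0 - lam * thetaEven τ 0) +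
        thetaOdd τ z * (d * thetaOdd ((d : ℂ) ^ 2 * τ) 0 - lam * thetaOdd τ 0) = 0 := by
      intro z
      have h1 := (h z).2 0
      rw [sum_thetaSample hd hτ, thetaSample, hsq] at h1
      simp only [ZMod.val_zero, Nat.cast_zero, zero_div, add_zero] at h1
      linear_combination h1
    have k1 := key 0
    have k2 := key (0 + 1 / 2)
    rw [thetaEven_add_half, thetaOdd_add_half] at k2
    constructor
    · apply mul_left_cancel₀ (thetaEven_zero_ne_zero hτ)
      linear_combination (k1 + k2) / 2
    · apply mul_left_cancel₀ (thetaOdd_zero_ne_zero hτ)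
      linear_combination (k1 - k2) / 2
  · rintro ⟨h1, h2⟩ z
    refine ⟨thetaSample_ne_zero hd1 hτ z, fun t => ?_⟩
    rw [sum_thetaSample hd hτ, thetaSample, hsq, h1, h2]
    ring

theorem IsThetaCritical.conj {lam τ : ℂ} {d : ℕ} [NeZero d] (h : IsThetaCritical lam d τ) :
    IsThetaCritical (starRingEnd ℂ lam) d (-starRingEnd ℂ τ) := by
  intro z
  have hf : thetaSample d (-starRingEnd ℂ τ) z =
      fun l => starRingEnd ℂ (thetaSample d τ (starRingEnd ℂ z) l) := by
    funext l
    rw [thetaSample, thetaSample, jacobiTheta₂_conj, map_add, map_div₀, Complex.conj_conj,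
      Complex.conj_natCast, Complex.conj_natCast]
  obtain ⟨h1, h2⟩ := h (starRingEnd ℂ z)
  rw [hf]
  refine ⟨fun h0 => h1 (funext fun l => ?_), fun t => ?_⟩
  · simpa using congrFun h0 l
  · have := congrArg (starRingEnd ℂ) (h2 t)
    simpa [map_sum] using this

/-! ### The matrix attached to a critical parameter -/

theorem intCast_mul_add_intCast_ne_zero {α β c δ : ℤ} (hdet : α * δ - β * c = 1) {τ : ℂ}
    (hτ : 0 < τ.im) : (c : ℂ) * τ + δ ≠ 0 := by
  intro h
  have him := congrArg Complex.im h
  rw [intCast_mul_add_intCast_im, Complex.zero_im, mul_eq_zero, or_iff_left hτ.ne'] at him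
  have hc : c = 0 := by exact_mod_cast him
  subst hc
  have hδ : δ = 0 := by simpa using h
  simp [hδ] at hdet

theorem int_gcd_natAbs_eq_one {α β c δ : ℤ} (hdet : α * δ - β * c = 1) :
    Int.gcd |c| (δ.natAbs : ℤ) = 1 := by
  have h : IsCoprime c δ := ⟨-β, α, by linear_combination hdet⟩
  rw [Int.isCoprime_iff_gcd_eq_one] at h
  simpa [Int.gcd, Int.natAbs_abs] using h

theorem isThetaCritical_iff_of_matrix {d : ℕ} [NeZero d] (hd : Odd d) (hd1 : 1 < d) {τ : ℂ}
    (hτ : 0 < τ.im) {α β c δ : ℤ} (hdet : α * δ - β * c = 1) (hc : 4 ∣ c) (hβ : 4 ∣ β)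
    (hδ : δ % 4 = 1) (hfix : (d : ℂ) ^ 2 * τ * (c * τ + δ) = α * τ + β) (lam : ℂ) :
    IsThetaCritical lam d τ ↔ lam = (J(|c| | δ.natAbs) : ℂ) * (d * (c * τ + δ).sqrt) := by
  have h0 := intCast_mul_add_intCast_ne_zero hdet hτ
  obtain ⟨h1, h2⟩ := thetaTransforms hdet hc hδ τ hτ
  rw [← hfix, mul_div_cancel_right₀ _ h0] at h1 h2
  rw [I_zpow_eq_of_four_dvd (n := 0) (by simpa using hβ), zpow_zero, one_mul] at h2
  rw [isThetaCritical_iff hd hd1 hτ, h1, h2]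
  constructor
  · rintro ⟨h3, -⟩
    apply mul_right_cancel₀ (thetaEven_zero_ne_zero hτ)
    linear_combination -h3
  · rintro rfl
    constructor <;> ring

theorem IsThetaCritical.exists_matrix {d : ℕ} [NeZero d] (hd : Odd d) {lam τ : ℂ}
    (hτ : 0 < τ.im) (h : IsThetaCritical lam d τ) :
    ∃ α β c δ : ℤ, α * δ - β * c = 1 ∧ 4 ∣ c ∧ 4 ∣ β ∧ δ % 4 = 1 ∧
      (d : ℂ) ^ 2 * τ * (c * τ + δ) = α * τ + β ∧ lam ^ 2 = (d : ℂ) ^ 2 * (c * τ + δ) := by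
  have hd1 := h.one_lt hτ
  have hd0 : (d : ℂ) ≠ 0 := Nat.cast_ne_zero.mpr (by omega)
  obtain ⟨h1, h2⟩ := (isThetaCritical_iff hd hd1 hτ lam).mp h
  obtain ⟨α, β, c, δ, hdet, hc, hβ, hδ, hfix⟩ :=
    exists_gamma_four_of_proportional (natCast_sq_mul_im_pos hτ d) hτ (κ := lam / d)
      (by field_simp; linear_combination h1) (by field_simp; linear_combination h2)
  refine ⟨α, β, c, δ, hdet, hc, hβ, hδ, hfix, ?_⟩
  have h3 := (isThetaCritical_iff_of_matrix hd hd1 hτ hdet hc hβ hδ hfix lam).mp h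
  have hJ : (J(|c| | δ.natAbs) : ℂ) ^ 2 = 1 := by
    exact_mod_cast jacobiSym.sq_one (int_gcd_natAbs_eq_one hdet)
  rw [h3, mul_pow, mul_pow, hJ, Complex.sqrt_pow_two, one_mul]

/-- The multiplier `μ = d² (c τ + δ)` of a matrix fixing `τ` up to the factor `d²` is a non-real
root of `X² - T X + d²`, where `T = α + d² δ`. -/
theorem multiplier_re_im {d : ℕ} {τ : ℂ} (hτ : 0 < τ.im) (hd1 : 1 < d) {α β c δ : ℤ}
    (hdet : α * δ - β * c = 1) (hfix : (d : ℂ) ^ 2 * τ * (c * τ + δ) = α * τ + β) {μ : ℂ}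
    (hμ : μ = (d : ℂ) ^ 2 * (c * τ + δ)) :
    2 * μ.re = ((α + d ^ 2 * δ : ℤ) : ℝ) ∧ μ.im ≠ 0 ∧
      4 * μ.im ^ 2 = 4 * d ^ 2 - ((α + d ^ 2 * δ : ℤ) : ℝ) ^ 2 := by
  have him : μ.im = d ^ 2 * (c * τ.im) := by
    rw [hμ, ← intCast_mul_add_intCast_im c δ, show ((d : ℂ) ^ 2) = ((d ^ 2 : ℝ) : ℂ) by push_cast; rfl,
      im_ofReal_mul]
  have hd0 : (d : ℝ) ≠ 0 := Nat.cast_ne_zero.mpr (by omega)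
  -- If c = 0, then α = d²δ and the determinant gives d²δ² = 1, impossible for d > 1.
  have hc : c ≠ 0 := by
    rintro rfl
    have h1 := congrArg Complex.im hfix
    rw [intCast_mul_add_intCast_im, show (d : ℂ) ^ 2 * τ * (((0 : ℤ) : ℂ) * τ + δ) =
      ((d ^ 2 * δ : ℤ) : ℂ) * τ + ((0 : ℤ) : ℂ) by push_cast; ring,
      intCast_mul_add_intCast_im] at h1
    have h2 : (d ^ 2 * δ : ℤ) = α := by exact_mod_cast mul_right_cancel₀ hτ.ne' h1
    have h3 : (d : ℤ) * (d * δ ^ 2) = 1 := by linear_combination hdet + δ * h2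
    rcases Int.eq_one_or_neg_one_of_mul_eq_one h3 with h | h <;> omega
  have him0 : μ.im ≠ 0 := by
    rw [him]
    exact mul_ne_zero (pow_ne_zero 2 hd0) (mul_ne_zero (Int.cast_ne_zero.mpr hc) hτ.ne')
  have hquad : μ ^ 2 - ((α + d ^ 2 * δ : ℤ) : ℝ) * μ + (d ^ 2 : ℝ) = 0 := by
    have hdet' : (α : ℂ) * δ - β * c = 1 := by exact_mod_cast hdet
    rw [hμ]
    push_cast
    linear_combination (d : ℂ) ^ 2 * c * hfix - (d : ℂ) ^ 2 * hdet'
  generalize ((α + d ^ 2 * δ : ℤ) : ℝ) = T at *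
  have hre := congrArg Complex.re hquad
  have hi := congrArg Complex.im hquad
  simp only [sq, add_re, sub_re, mul_re, ofReal_re, ofReal_im, add_im, sub_im, mul_im, zero_re,
    zero_im, zero_mul, sub_zero, add_zero] at hre hi
  have hx : 2 * μ.re = T := by
    apply mul_right_cancel₀ him0
    linear_combination hi
  refine ⟨hx, him0, ?_⟩
  rw [← hx]
  rw [← hx] at hre
  linear_combination -4 * hre

/-! ### Admissible pairs -/

theorem IsAdmissiblePair.one_lt {d a b : ℕ} (h : IsAdmissiblePair d a b) : 1 < d := by
  obtain ⟨ha, hb, hab, -⟩ := h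
  omega

theorem lambdaZero_re (a b : ℕ) : (lambdaZero a b).re = √(a : ℝ) := by
  simp [lambdaZero]

theorem lambdaZero_sq (a b : ℕ) :
    lambdaZero a b ^ 2 = a - b + 2 * I * (√((a : ℝ) * (b : ℝ)) : ℂ) := by
  have h1 : ((√(a : ℝ) : ℝ) : ℂ) ^ 2 = a := by
    rw [← ofReal_pow, Real.sq_sqrt (Nat.cast_nonneg a), ofReal_natCast]
  have h2 : ((√(b : ℝ) : ℝ) : ℂ) ^ 2 = b := by
    rw [← ofReal_pow, Real.sq_sqrt (Nat.cast_nonneg b), ofReal_natCast]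
  rw [lambdaZero, Real.sqrt_mul (Nat.cast_nonneg a), ofReal_mul]
  linear_combination h1 + I ^ 2 * h2 + (b : ℂ) * I_sq

theorem lambdaZero_sq_re (a b : ℕ) : (lambdaZero a b ^ 2).re = a - b := by
  rw [lambdaZero_sq]
  simp

theorem lambdaZero_sq_im (a b : ℕ) : (lambdaZero a b ^ 2).im = 2 * √((a : ℝ) * b) := by
  rw [lambdaZero_sq]
  simp

theorem lambdaZero_sq_im_pos {d a b : ℕ} (h : IsAdmissiblePair d a b) :
    0 < (lambdaZero a b ^ 2).im := by
  have ha : (0 : ℝ) < a := Nat.cast_pos.mpr h.1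
  have hb : (0 : ℝ) < b := Nat.cast_pos.mpr h.2.1
  rw [lambdaZero_sq_im]
  positivity

theorem lambdaZero_sq_quadratic {d a b : ℕ} (hab : a + b = d) :
    (lambdaZero a b ^ 2) ^ 2 = 2 * (a - b) * lambdaZero a b ^ 2 - (d : ℂ) ^ 2 := by
  have h : ((√((a : ℝ) * b) : ℝ) : ℂ) ^ 2 = a * b := by
    rw [← ofReal_pow, Real.sq_sqrt (by positivity)]
    push_cast
    rfl
  rw [lambdaZero_sq, ← hab]
  push_cast
  linear_combination 4 * I ^ 2 * h + 4 * (a : ℂ) * b * I_sq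

theorem tauZero_eq {d : ℕ} [NeZero d] (a b : ℕ) :
    (d : ℂ) ^ 2 * (4 * tauZero d a b + 1) = lambdaZero a b ^ 2 := by
  have hd : (d : ℂ) ≠ 0 := Nat.cast_ne_zero.mpr (NeZero.ne d)
  rw [lambdaZero_sq, tauZero]
  field_simp
  ring

theorem tauZero_im_pos {d : ℕ} [NeZero d] {a b : ℕ} (h : IsAdmissiblePair d a b) :
    0 < (tauZero d a b).im := by
  have h1 := lambdaZero_sq_im_pos h
  rw [← tauZero_eq (d := d), show (d : ℂ) ^ 2 * (4 * tauZero d a b + 1) =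
    ((4 * d ^ 2 : ℤ) : ℂ) * tauZero d a b + ((d ^ 2 : ℤ) : ℂ) by push_cast; ring,
    intCast_mul_add_intCast_im] at h1
  exact pos_of_mul_pos_right h1 (by positivity)

/-- Expand |4d²(k+τ₀)|² using 4d²(k+τ₀) = d²(4k-1) + λ₀² and |λ₀²| = d. In this form N_k becomes a
determinant condition. -/
theorem isNk_iff {d : ℕ} [NeZero d] {a b : ℕ} (hab : a + b = d) (k N : ℤ) :
    IsNk d a b k N ↔ 16 * N = d ^ 2 * (4 * k - 1) ^ 2 + 2 * (4 * k - 1) * (a - b) + 1 := by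
  have hd : (d : ℝ) ≠ 0 := Nat.cast_ne_zero.mpr (NeZero.ne d)
  have h1 : (4 * d ^ 2 : ℝ) * (k + tauZero d a b) =
      ((d ^ 2 * (4 * k - 1) : ℝ) : ℂ) + lambdaZero a b ^ 2 := by
    rw [← tauZero_eq (d := d)]
    push_cast
    ring
  have h2 : ‖(4 * d ^ 2 : ℝ) * (k + tauZero d a b)‖ ^ 2 =
      (d ^ 2 * (4 * k - 1) + (a - b)) ^ 2 + 4 * (a * b) := by
    rw [h1, ← Complex.normSq_eq_norm_sq, Complex.normSq_apply, add_re, add_im, ofReal_re,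
      ofReal_im, lambdaZero_sq_re, lambdaZero_sq_im]
    have := Real.sq_sqrt (show (0 : ℝ) ≤ a * b by positivity)
    linear_combination 4 * this
  rw [norm_mul, mul_pow, Complex.norm_real, Real.norm_eq_abs, sq_abs] at h2
  have hab' : (a : ℝ) + b = d := by exact_mod_cast hab
  have h3 : (d : ℝ) ^ 2 * (16 * (d ^ 2 * ‖(k : ℂ) + tauZero d a b‖ ^ 2)) =
      d ^ 2 * (d ^ 2 * (4 * k - 1) ^ 2 + 2 * (4 * k - 1) * (a - b) + 1) := by
    linear_combination h2 + (a + b + d) * hab'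
  have h4 := mul_left_cancel₀ (pow_ne_zero 2 hd) h3
  rw [IsNk, ← @Int.cast_inj ℝ]
  push_cast
  rw [← h4]
  constructor
  · intro h
    rw [h]
  · intro h
    linarith

theorem odd_succ_sq_div_four (e : ℕ) : (2 * e + 1 + 1) ^ 2 / 4 = (e + 1) ^ 2 := by
  rw [show (2 * e + 1 + 1) ^ 2 = (e + 1) ^ 2 * 4 by ring, Nat.mul_div_cancel _ (by norm_num)]

theorem IsAdmissiblePair.exists_isNk {d : ℕ} [NeZero d] (hd : Odd d) {a b : ℕ}
    (h : IsAdmissiblePair d a b) (k : ℤ) : ∃ N : ℤ, IsNk d a b k N := by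
  obtain ⟨-, -, hab, hmod⟩ := h
  obtain ⟨e, rfl⟩ := hd
  rw [odd_succ_sq_div_four, Nat.modEq_iff_dvd] at hmod
  obtain ⟨j, hj⟩ := hmod
  push_cast at hj
  -- Obtained by substituting a = (e+1)² - 4j. At k = 0 integrality reads 16 ∣ (d+1)² - 4a, which is
  -- admissibility.
  refine ⟨k ^ 2 * (2 * e + 1) ^ 2 - k * (2 * e + 1) * (e + 1) + k * (e + 1) ^ 2 - j * (4 * k - 1),
    (isNk_iff hab k _).mpr ?_⟩
  have hb : (b : ℤ) = 2 * e + 1 - a := by omega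
  rw [hb]
  push_cast
  linear_combination 4 * (4 * k - 1) * hj

/-! ### Classification of the critical parameters. -/

/-- The parameters `(k + τ₀) / p` are critical, with the sign given by a Jacobi symbol. -/
theorem IsAdmissiblePair.isThetaCritical_iff {d : ℕ} [NeZero d] (hd : Odd d) {a b : ℕ}
    (h : IsAdmissiblePair d a b) {k : ℤ} {p : ℕ} {N : ℤ} (hp : 0 < p) (hN : IsNk d a b k N)
    (hpN : (p : ℤ) ∣ N) :
    (signSymbol k p = 1 ∨ signSymbol k p = -1) ∧
      ∀ lam : ℂ, IsThetaCritical lam d (((k : ℂ) + tauZero d a b) / (p : ℂ)) ↔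
        lam = (signSymbol k p : ℂ) * lambdaZero a b := by
  have hab := h.2.2.1
  rw [isNk_iff hab] at hN
  obtain ⟨r, rfl⟩ := hpN
  -- The matrix has c = 4p and β = -4r, where N_k = pr; α is forced by the trace condition α + d²δ =
  -- 2(a-b).
  set δ : ℤ := 1 - 4 * k with hδ
  set α : ℤ := 2 * (a - b) - d ^ 2 * δ with hα
  have hdet : α * δ - -4 * r * (4 * p) = 1 := by
    rw [hα, hδ]
    linear_combination hN
  have hnat : (4 * k - 1).natAbs = δ.natAbs := by rw [hδ]; omega
  have hodd : Odd δ.natAbs := Int.natAbs_odd.mpr (Int.odd_iff.mpr (by omega))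
  have hJ : J(|(4 * p : ℤ)| | δ.natAbs) = signSymbol k p := by
    rw [signSymbol, hnat, abs_of_nonneg (by positivity), jacobiSym.mul_left,
      jacobiSym.at_four hodd, one_mul]
  refine ⟨?_, ?_⟩
  · rw [← hJ]
    exact jacobiSym.eq_one_or_neg_one (int_gcd_natAbs_eq_one hdet)
  · have hp0 : (p : ℂ) ≠ 0 := Nat.cast_ne_zero.mpr hp.ne'
    have hd0 : (d : ℂ) ≠ 0 := Nat.cast_ne_zero.mpr (NeZero.ne d)
    set τ : ℂ := ((k : ℂ) + tauZero d a b) / (p : ℂ) with hτdef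
    have hτ : 0 < τ.im := by
      rw [hτdef, ← ofReal_natCast, div_ofReal_im]
      have h1 := tauZero_im_pos h
      have h2 : (0 : ℝ) < p := Nat.cast_pos.mpr hp
      simpa using div_pos h1 h2
    have hμ : (d : ℂ) ^ 2 * (((4 * p : ℤ) : ℂ) * τ + δ) = lambdaZero a b ^ 2 := by
      rw [← tauZero_eq (d := d), hτdef, hδ]
      push_cast
      field_simp
      ring
    have hq := lambdaZero_sq_quadratic hab
    have hfix : (d : ℂ) ^ 2 * τ * (((4 * p : ℤ) : ℂ) * τ + δ) = α * τ + ((-4 * r : ℤ) : ℂ) := by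
      have hdet' : (α : ℂ) * δ - -4 * r * (4 * p) = 1 := by exact_mod_cast hdet
      have hα' : (α : ℂ) = 2 * (a - b) - d ^ 2 * δ := by rw [hα]; push_cast; ring
      rw [← hμ] at hq
      apply mul_left_cancel₀ (mul_ne_zero (pow_ne_zero 2 hd0) (mul_ne_zero (by norm_num : (4 : ℂ) ≠ 0) hp0))
      push_cast at hq ⊢
      linear_combination hq + (d : ℂ) ^ 2 * hdet' - (d : ℂ) ^ 2 * (4 * p * τ + δ) * hα'
    -- λ₀/d is the principal root because its real part √a/d is positive.
    have hsqrt : (d : ℂ) * (((4 * p : ℤ) : ℂ) * τ + δ).sqrt = lambdaZero a b := by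
      rw [Complex.sqrt_eq_of_sq (z := lambdaZero a b / d)]
      · field_simp
      · rw [div_pow, ← hμ]
        field_simp
      · rw [← ofReal_natCast, div_ofReal_re, lambdaZero_re]
        have h1 : (0 : ℝ) < a := Nat.cast_pos.mpr h.1
        have h2 : (0 : ℝ) < d := Nat.cast_pos.mpr (Nat.pos_of_ne_zero (NeZero.ne d))
        positivity
    intro lam
    rw [isThetaCritical_iff_of_matrix hd h.one_lt hτ hdet ⟨p, rfl⟩ ⟨-r, by ring⟩ (by omega) hfix,
      hJ, hsqrt]

/-- Any critical parameter with `λ² = λ₀²` has the form `(k + τ₀) / p`. -/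
theorem IsThetaCritical.exists_eq_div {d : ℕ} [NeZero d] (hd : Odd d) {a b : ℕ}
    (hab : IsAdmissiblePair d a b) {lam τ : ℂ} (hτ : 0 < τ.im) (h : IsThetaCritical lam d τ)
    (hlam : lam ^ 2 = lambdaZero a b ^ 2) :
    ∃ (k : ℤ) (p : ℕ) (N : ℤ), 0 < p ∧ IsNk d a b k N ∧ (p : ℤ) ∣ N ∧
      τ = ((k : ℂ) + tauZero d a b) / (p : ℂ) := by
  have hd0 : (d : ℂ) ≠ 0 := Nat.cast_ne_zero.mpr (NeZero.ne d)
  obtain ⟨α, β, c, δ, hdet, ⟨p, rfl⟩, ⟨r, rfl⟩, hδ, hfix, hsq⟩ := h.exists_matrix hd hτ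
  rw [hlam] at hsq
  obtain ⟨hre, -, -⟩ := multiplier_re_im hτ hab.one_lt hdet hfix hsq
  rw [lambdaZero_sq_re] at hre
  have hT : 2 * ((a : ℤ) - b) = α + d ^ 2 * δ := by exact_mod_cast hre
  -- λ² = λ₀² lies in the upper half-plane, which fixes the sign of c = 4p.
  have hp : 0 < p := by
    have h1 := lambdaZero_sq_im_pos hab
    rw [hsq, show ((d : ℂ) ^ 2) = ((d ^ 2 : ℝ) : ℂ) by push_cast; rfl, im_ofReal_mul,
      intCast_mul_add_intCast_im] at h1
    have h2 := pos_of_mul_pos_left (pos_of_mul_pos_right h1 (by positivity)) hτ.le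
    have h3 : 0 < 4 * p := by exact_mod_cast h2
    omega
  lift p to ℕ using hp.le
  obtain ⟨k, hk⟩ : ∃ k, δ = 1 - 4 * k := ⟨-(δ / 4), by omega⟩
  have hp0 : (p : ℂ) ≠ 0 := by
    rw [Nat.cast_ne_zero]
    omega
  refine ⟨k, p, p * -r, by exact_mod_cast hp, (isNk_iff hab.2.2.1 _ _).mpr ?_, ⟨-r, rfl⟩, ?_⟩
  · rw [hk] at hdet hT
    linear_combination hdet + (1 - 4 * k) * hT
  · rw [← tauZero_eq (d := d)] at hsq
    have h1 := mul_left_cancel₀ (pow_ne_zero 2 hd0) hsq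
    rw [eq_div_iff hp0]
    rw [hk] at h1
    push_cast at h1
    linear_combination -h1 / 4

/-- The critical values are `± √a ± i √b` with `(a, b)` admissible. -/
theorem IsThetaCritical.exists_isAdmissiblePair {d : ℕ} [NeZero d] (hd : Odd d) {lam τ : ℂ}
    (hτ : 0 < τ.im) (h : IsThetaCritical lam d τ) :
    ∃ a b : ℕ, IsAdmissiblePair d a b ∧
      ∃ s t : ℂ, (s = 1 ∨ s = -1) ∧ (t = 1 ∨ t = -1) ∧
        lam = s * (√(a : ℝ) : ℂ) + t * (I * (√(b : ℝ) : ℂ)) := by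
  have hd1 := h.one_lt hτ
  obtain ⟨α, β, c, δ, hdet, ⟨p, rfl⟩, ⟨r, rfl⟩, hδ, hfix, hsq⟩ := h.exists_matrix hd hτ
  obtain ⟨hre, him, him2⟩ := multiplier_re_im hτ hd1 hdet hfix hsq
  obtain ⟨e, he⟩ := hd
  obtain ⟨y, rfl⟩ : ∃ y, δ = 4 * y + 1 := ⟨δ / 4, by omega⟩
  obtain ⟨x, rfl⟩ : ∃ x, α = 4 * x + 1 :=
    ⟨4 * r * p - α * y, by linear_combination hdet⟩
  -- Since α ≡ δ ≡ 1 mod 4 and 16 ∣ βc, the determinant gives 4 ∣ x + y. This yields T = 4a' - 2d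
  -- with a' ≡ (d+1)²/4 mod 4.
  have hxy : x + y = 4 * (r * p - x * y) := by linarith
  set j : ℤ := r * p - x * y + (e ^ 2 + e) * y with hj
  have heZ : (d : ℤ) = 2 * e + 1 := by exact_mod_cast he
  have hT : 4 * x + 1 + (d : ℤ) ^ 2 * (4 * y + 1) = 4 * ((e + 1) ^ 2 + 4 * j) - 2 * d := by
    rw [hj, heZ]
    linear_combination 4 * hxy
  set a' : ℤ := (e + 1) ^ 2 + 4 * j with ha'
  rw [hT] at hre him2
  push_cast at hre him2
  -- 4d² - T² = 16a'(d - a') is positive because λ² is non-real, so a' and d - a' are both positive.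
  have hprod : (0 : ℝ) < a' * (d - a') := by
    have : 0 < (lam ^ 2).im ^ 2 := by positivity
    linarith
  have hprod' : 0 < a' * (d - a') := by exact_mod_cast hprod
  have hdpos : (0 : ℤ) < d := by omega
  have ha0 : 0 < a' := by
    by_contra! hle
    nlinarith
  have hb0 : 0 < d - a' := pos_of_mul_pos_right hprod' ha0.le
  clear_value a'
  lift a' to ℕ using ha0.le
  obtain ⟨b, hb⟩ : ∃ b : ℕ, a' + b = d := ⟨d - a', by omega⟩
  have hbR : (b : ℝ) = d - a' := by
    rw [← hb]
    push_cast
    ring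
  push_cast at hre him2 hprod
  refine ⟨a', b, ⟨by omega, by omega, hb, ?_⟩, ?_⟩
  · rw [he, odd_succ_sq_div_four, Nat.modEq_iff_dvd]
    exact ⟨-j, by push_cast; linear_combination -ha'⟩
  · have hmul : (√(a' : ℝ) * √(b : ℝ)) ^ 2 = a' * b := by
      rw [mul_pow, Real.sq_sqrt (Nat.cast_nonneg _), Real.sq_sqrt (Nat.cast_nonneg _)]
    have hsa : (√(a' : ℝ)) ^ 2 = a' := Real.sq_sqrt (Nat.cast_nonneg _)
    have hsb : (√(b : ℝ)) ^ 2 = b := Real.sq_sqrt (Nat.cast_nonneg _)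
    have him3 : (lam ^ 2).im ^ 2 = (2 * (√(a' : ℝ) * √(b : ℝ))) ^ 2 := by
      rw [mul_pow, hmul, hbR]
      linear_combination him2 / 4
    obtain ⟨t, ht, hlam⟩ : ∃ t : ℝ, (t = 1 ∨ t = -1) ∧
        (lam ^ 2).im = t * (2 * (√(a' : ℝ) * √(b : ℝ))) := by
      rcases sq_eq_sq_iff_eq_or_eq_neg.mp him3 with h1 | h1
      · exact ⟨1, Or.inl rfl, by rw [h1, one_mul]⟩
      · exact ⟨-1, Or.inr rfl, by rw [h1]; ring⟩
    have ht2 : t ^ 2 = 1 := by rcases ht with rfl | rfl <;> norm_num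
    have hL : lam ^ 2 = ((√(a' : ℝ) : ℂ) + t * (I * (√(b : ℝ) : ℂ))) ^ 2 := by
      have hz : ((√(a' : ℝ) : ℂ) + t * (I * (√(b : ℝ) : ℂ))) =
          ((√(a' : ℝ) : ℝ) : ℂ) + ((t * √(b : ℝ) : ℝ) : ℂ) * I := by
        push_cast
        ring
      rw [hz]
      apply Complex.ext
      · rw [sq, sq, mul_re, mul_re]
        rw [sq, mul_re] at hre
        simp only [add_re, add_im, ofReal_re, ofReal_im, mul_re, mul_im, I_re, I_im]
        rw [hbR] at hsb
        rw [hbR]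
        linear_combination hre / 2 - hsa + hsb * t ^ 2 + (d - a') * ht2
      · rw [hlam, sq, mul_im]
        simp only [add_re, add_im, ofReal_re, ofReal_im, mul_re, mul_im, I_re, I_im]
        ring
    have ht' : (t : ℂ) = 1 ∨ (t : ℂ) = -1 := by
      rcases ht with rfl | rfl
      · exact Or.inl ofReal_one
      · exact Or.inr (by push_cast; rfl)
    rcases sq_eq_sq_iff_eq_or_eq_neg.mp hL with h1 | h1
    · exact ⟨1, t, Or.inl rfl, ht', by rw [h1, one_mul]⟩
    · refine ⟨-1, -t, Or.inr rfl, ?_, by rw [h1]; ring⟩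
      rcases ht' with h2 | h2 <;> simp [h2]

theorem proposition3p2 (d : ℕ) [NeZero d] (hd : Odd d) :
    -- (a), (c), (d), for each admissible pair
    (∀ a b : ℕ, IsAdmissiblePair d a b →
      -- (a)
      (0 < (tauZero d a b).im ∧ IsThetaCritical (lambdaZero a b) d (tauZero d a b)) ∧
      -- (c)
      (∀ k : ℤ, ∃ N : ℤ, IsNk d a b k N) ∧
      (∀ τ : ℂ, 0 < τ.im →
        ((IsThetaCritical (lambdaZero a b) d τ ∨ IsThetaCritical (-lambdaZero a b) d τ) ↔
          ∃ (k : ℤ) (p : ℕ) (N : ℤ), 0 < p ∧ IsNk d a b k N ∧ (p : ℤ) ∣ N ∧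
            τ = ((k : ℂ) + tauZero d a b) / (p : ℂ))) ∧
      -- (d)
      (∀ (k : ℤ) (p : ℕ) (N : ℤ), 0 < p → IsNk d a b k N → (p : ℤ) ∣ N →
        (signSymbol k p = 1 ∨ signSymbol k p = -1) ∧
        ∀ lam : ℂ, IsThetaCritical lam d (((k : ℂ) + tauZero d a b) / (p : ℂ)) ↔
          lam = (signSymbol k p : ℂ) * lambdaZero a b)) ∧
    -- (b)
    (∀ lam τ : ℂ, 0 < τ.im → IsThetaCritical lam d τ →
      ∃ a b : ℕ, IsAdmissiblePair d a b ∧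
        ∃ s t : ℂ, (s = 1 ∨ s = -1) ∧ (t = 1 ∨ t = -1) ∧
          lam = s * (√(a : ℝ) : ℂ) + t * (I * (√(b : ℝ) : ℂ))) ∧
    -- complex conjugation, which reduces the remaining signs in (b) to those in (c)
    (∀ lam τ : ℂ, 0 < τ.im →
      (IsThetaCritical lam d τ ↔
        IsThetaCritical (starRingEnd ℂ lam) d (-starRingEnd ℂ τ))) := by

  refine ⟨fun a b hab => ⟨⟨tauZero_im_pos hab, ?_⟩, hab.exists_isNk hd, fun τ hτ => ⟨?_, ?_⟩,
    fun k p N hp hN hpN => hab.isThetaCritical_iff hd hp hN hpN⟩,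
    fun lam τ hτ h => h.exists_isAdmissiblePair hd hτ, fun lam τ _ => ⟨fun h => h.conj, fun h => ?_⟩⟩
  -- Part (a) is the case k = 0, p = 1, where the symbol is trivial.
  · obtain ⟨N, hN⟩ := hab.exists_isNk hd 0
    have h := ((hab.isThetaCritical_iff hd one_pos hN (by simp)).2 (lambdaZero a b)).mpr
      (by simp [signSymbol])
    simpa using h
  · rintro (h | h)
    · exact h.exists_eq_div hd hab hτ rfl
    · exact h.exists_eq_div hd hab hτ (neg_sq _)
  · rintro ⟨k, p, N, hp, hN, hpN, rfl⟩
    obtain ⟨hs, hiff⟩ := hab.isThetaCritical_iff hd hp hN hpN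
    rw [hiff, hiff]
    rcases hs with hs | hs <;> simp [hs]
  · simpa using h.conj
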